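/- Let $A$ be a finite set of agents and $Prop$ a set of atomic propositions. The language of $LDC\preceq$ is given by $$\varphi ::= p \mid \neg\varphi \mid \varphi\wedge\varphi \mid D_B\varphi \mid C_B\varphi \mid B\preceq C \qquad (p\in Prop,\ B,C\subseteq A),$$ with $\to$ defined from $\neg,\wedge$ as usual and $K_a\varphi := D_{\{a\}}\varphi$. The language of $LD\preceq$ is the fragment without the operators $C_B$. An epistemic model consists of a set $S$ of states, an equivalence relation $\sim_a$ on $S$ for each $a\in A$, and a truth assignment $Prop\to\{0,1\}$ at each state. For $B\subseteq A$ put $\sim_B\,:=\bigcap_{b\in B}\sim_b$ (so $\sim_\emptyset\,=S\times S$) and $\sim^B\,:=(\bigcup_{b\in B}\sim_b)^*$, the reflexive-transitive closure. Atoms and Boolean connectives are interpreted as usual; $D_B$ and $C_B$ are the Kripke modalities of $\sim_B$ and $\sim^B$, that is, $s\models D_B\varphi$ iff $t\models\varphi$ for all $t$ with $s\sim_B t$, and $s\models C_B\varphi$ iff $t\models\varphi$ for all $t$ with $s\sim^B t$; and $s\models B\preceq C$ iff for all $t\in S$, $s\sim_B t$ implies $s\sim_C t$. A formula is valid if it is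 true at all states of all epistemic models. The proof system $\mathbf{LDC\preceq}$ has the following axioms and rules, for all formulas $\varphi,\psi$ of the language and all groups $B,C,E\subseteq A$. (I) All instances of classical propositional tautologies, and modus ponens. (II) From $\varphi$ infer $D_B\varphi$; $D_B(\varphi\to\psi)\to(D_B\varphi\to D_B\psi)$; $D_B\varphi\to\varphi$; $D_B\varphi\to D_BD_B\varphi$; $\neg D_B\varphi\to D_B\neg D_B\varphi$. (III) $B\preceq C$, provided that $C\subseteq B$; $(B\preceq C\wedge B\preceq E)\to B\preceq C\cup E$; $(B\preceq C\wedge C\preceq E)\to B\preceq E$; $B\preceq C\to D_B(B\preceq C)$; $B\preceq C\to(D_C\varphi\to D_B\varphi)$. (IV) From $\varphi$ infer $C_B\varphi$; $C_B(\varphi\to\psi)\to(C_B\varphi\to C_B\psi)$; $C_B\varphi\to(\varphi\wedge\bigwedge_{b\in B}K_bC_B\varphi)$; $C_B(\varphi\to\bigwedge_{b\in B}K_b\varphi)\to(\varphi\to C_B\varphi)$. (The empty conjunction is a fixed true formula.) The proof system $\mathbf{LD\preceq}$ consists of groups (I)–(III), over the language of $LD\preceq$. Then: 1. The logic $LDC\preceq$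 is decidable: if $Prop$ is effectively numbered, there is an algorithm that decides whether a given formula of $LDC\preceq$ is valid. 2. A formula of $LDC\preceq$ is a theorem of $\mathbf{LDC\preceq}$ if and only if it is valid. 3. A formula of $LD\preceq$ is a theorem of $\mathbf{LD\preceq}$ if and only if it is valid. -/

import Mathlib

universe u v w

namespace EpistemicLogic

/-- Formulas over the agents `A` and the atomic propositions `P`.  Groups of agents are finite sets
of agents (all groups are allowed, also the empty one).  The flag `ck` says whether
common knowledge operators belong to the language: `Form A P true` is the language of `LDC⪯`,
and `Form A P false` is that of its fragment `LD⪯`, without common knowledge. -/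
inductive Form (A : Type u) (P : Type v) (ck : Bool) : Type (max u v)
  /-- an atomic proposition -/
  | atom (p : P) : Form A P ck
  /-- negation -/
  | neg (φ : Form A P ck) : Form A P ck
  /-- conjunction -/
  | and (φ ψ : Form A P ck) : Form A P ck
  /-- distributed knowledge `D_B φ` -/
  | dist (B : Finset A) (φ : Form A P ck) : Form A P ck
  /-- the comparison `B ⪯ C`: group `B` knows at least as much as group `C` -/
  | cmp (B C : Finset A) : Form A P ck
  /-- common knowledge `C_B φ` (only if the language has it) -/
  | common (h : ck = true) (B : Finset A) (φ : Form A P ck) : Form A P ck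

namespace Form

variable {A : Type u} {P : Type v} {ck : Bool}

/-- Material implication, `¬ (φ ∧ ¬ ψ)`. -/
def imp (φ ψ : Form A P ck) : Form A P ck := neg (and φ (neg ψ))

/-- Individual knowledge, `K_a φ := D_{a} φ`. -/
def know (a : A) (φ : Form A P ck) : Form A P ck := dist {a} φ

/-- A fixed true formula, the value of the empty conjunction (`Prop` may be empty, so it is not
built from an atom). -/
def top : Form A P ck := cmp ∅ ∅

/-- The conjunction of a finite list of formulas. -/
def conj : List (Form A P ck) → Form A P ck
  | [] => top
  | [φ] => φ
  | φ :: ψ :: l => and φ (conj (ψ :: l))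

/-- `⋀_{b ∈ B} K_b φ`. -/
noncomputable def everyKnows (B : Finset A) (φ : Form A P ck) : Form A P ck :=
  conj (B.toList.map fun b => know b φ)

/-- `φ` is an instance of a tautology of classical propositional logic: it is true under
every truth assignment that respects negation and conjunction. -/
def Tautology (φ : Form A P ck) : Prop :=
  ∀ v : Form A P ck → Prop,
    (∀ χ, v (neg χ) ↔ ¬ v χ) → (∀ χ θ, v (and χ θ) ↔ (v χ ∧ v θ)) → v φ

end Form

/-- Epistemic models: a set of states, an equivalence relation for every agent, and
a truth assignment at every state. -/
structure Model (A : Type u) (P : Type v) where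
  /-- the states -/
  State : Type w
  /-- indistinguishability for an agent -/
  sim : A → State → State → Prop
  /-- indistinguishability relations are equivalence relations -/
  sim_equiv : ∀ a, Equivalence (sim a)
  /-- truth of the atomic propositions at a state -/
  val : State → P → Prop

namespace Model

variable {A : Type u} {P : Type v}

/-- `∼_B`, the intersection of the relations `∼_b` for `b ∈ B`. -/
def distRel (M : Model.{u, v, w} A P) (B : Finset A) (s t : M.State) : Prop :=
  ∀ b ∈ B, M.sim b s t

/-- `∼^B`, the reflexive-transitive closure of the union of the relations `∼_b` for `b ∈ B`. -/
def commonRel (M : Model.{u, v, w} A P) (B : Finset A) : M.State → M.State → Prop :=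
  Relation.ReflTransGen fun s t => ∃ b ∈ B, M.sim b s t

/-- Satisfaction of a formula at a state. -/
def Sat (M : Model.{u, v, w} A P) {ck : Bool} : M.State → Form A P ck → Prop
  | s, .atom p => M.val s p
  | s, .neg φ => ¬ M.Sat s φ
  | s, .and φ ψ => M.Sat s φ ∧ M.Sat s ψ
  | s, .dist B φ => ∀ t, M.distRel B s t → M.Sat t φ
  | s, .cmp B C => ∀ t, M.distRel B s t → M.distRel C s t
  | s, .common _ B φ => ∀ t, M.commonRel B s t → M.Sat t φ

end Model

/-- Validity: truth at all states of all epistemic models. -/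
def Valid {A : Type u} {P : Type v} {ck : Bool} (φ : Form A P ck) : Prop :=
  ∀ (M : Model.{u, v, w} A P) (s : M.State), M.Sat s φ

open Form in
/-- Theorems of the proof systems: `ck = true` gives the system `LDC⪯`, `ck = false` gives
the system `LD⪯`, which has no axioms and rules for common knowledge. -/
inductive Provable {A : Type u} {P : Type v} [DecidableEq A] {ck : Bool} : Form A P ck → Prop
  -- (I) classical propositional logic
  | taut {φ : Form A P ck} (h : Tautology φ) : Provable φ
  | modusPonens {φ ψ : Form A P ck} (h₁ : Provable (imp φ ψ)) (h₂ : Provable φ) : Provable ψ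
  -- (II) S5 axioms and rules for distributed knowledge
  | distNec (B : Finset A) {φ : Form A P ck} (h : Provable φ) : Provable (dist B φ)
  | distDistribution (B : Finset A) (φ ψ : Form A P ck) :
      Provable (imp (dist B (imp φ ψ)) (imp (dist B φ) (dist B ψ)))
  | veracity (B : Finset A) (φ : Form A P ck) : Provable (imp (dist B φ) φ)
  | posIntrospection (B : Finset A) (φ : Form A P ck) :
      Provable (imp (dist B φ) (dist B (dist B φ)))
  | negIntrospection (B : Finset A) (φ : Form A P ck) :
      Provable (imp (neg (dist B φ)) (dist B (neg (dist B φ))))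
  -- (III) axioms for comparative knowledge
  | inclusion {B C : Finset A} (h : C ⊆ B) : Provable (cmp B C)
  | additivity (B C E : Finset A) :
      Provable (imp (and (cmp B C) (cmp B E)) (cmp B (C ∪ E)))
  | transitivity (B C E : Finset A) :
      Provable (imp (and (cmp B C) (cmp C E)) (cmp B E))
  | knownSuperiority (B C : Finset A) : Provable (imp (cmp B C) (dist B (cmp B C)))
  | knowledgeTransfer (B C : Finset A) (φ : Form A P ck) :
      Provable (imp (cmp B C) (imp (dist C φ) (dist B φ)))
  -- (IV) axioms and rules for common knowledge
  | commonNec (h : ck = true) (B : Finset A) {φ : Form A P ck} (hφ : Provable φ) :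
      Provable (common h B φ)
  | commonDistribution (h : ck = true) (B : Finset A) (φ ψ : Form A P ck) :
      Provable (imp (common h B (imp φ ψ)) (imp (common h B φ) (common h B ψ)))
  | commonFixedPoint (h : ck = true) (B : Finset A) (φ : Form A P ck) :
      Provable (imp (common h B φ) (and φ (everyKnows B (common h B φ))))
  | commonInduction (h : ck = true) (B : Finset A) (φ : Form A P ck) :
      Provable (imp (common h B (imp φ (everyKnows B φ))) (imp φ (common h B φ)))

/-- A numbering of the finitely many groups of agents. -/
noncomputable def groupCode {A : Type u} [Fintype A] [DecidableEq A] (B : Finset A) : ℕ :=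
  (Fintype.equivFin (Finset A) B : ℕ)

/-- The Gödel number of a formula. -/
noncomputable def Form.code {A : Type u} {P : Type v} {ck : Bool} [Fintype A] [DecidableEq A]
    [Encodable P] : Form A P ck → ℕ
  | .atom p => Nat.pair 1 (Encodable.encode p)
  | .neg φ => Nat.pair 2 φ.code
  | .and φ ψ => Nat.pair 3 (Nat.pair φ.code ψ.code)
  | .dist B φ => Nat.pair 4 (Nat.pair (groupCode B) φ.code)
  | .cmp B C => Nat.pair 5 (Nat.pair (groupCode B) (groupCode C))
  | .common _ B φ => Nat.pair 6 (Nat.pair (groupCode B) φ.code)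

/-- Different formulas have different Gödel numbers. -/
theorem Form.code_injective {A : Type u} {P : Type v} {ck : Bool} [Fintype A] [DecidableEq A]
    [Encodable P] : Function.Injective (Form.code : Form A P ck → ℕ) := by
  have hg : ∀ B C : Finset A, groupCode B = groupCode C → B = C := fun B C h =>
    (Fintype.equivFin (Finset A)).injective (Fin.ext h)
  intro φ
  induction φ with
  | atom p => intro ψ h; cases ψ <;> simp_all [Form.code, Nat.pair_eq_pair]
  | neg φ ih =>
    intro ψ h
    cases ψ <;> simp [Form.code, Nat.pair_eq_pair] at h ⊢
    exact ih h
  | and φ₁ φ₂ ih₁ ih₂ =>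
    intro ψ h
    cases ψ <;> simp [Form.code, Nat.pair_eq_pair] at h ⊢
    exact ⟨ih₁ h.1, ih₂ h.2⟩
  | dist B φ ih =>
    intro ψ h
    cases ψ <;> simp [Form.code, Nat.pair_eq_pair] at h ⊢
    exact ⟨hg _ _ h.1, ih h.2⟩
  | cmp B C =>
    intro ψ h
    cases ψ <;> simp [Form.code, Nat.pair_eq_pair] at h ⊢
    exact ⟨hg _ _ h.1, hg _ _ h.2⟩
  | common hc B φ ih =>
    intro ψ h
    cases ψ <;> simp [Form.code, Nat.pair_eq_pair] at h ⊢
    exact ⟨hg _ _ h.1, ih h.2⟩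

/-- A set of formulas is decidable: there is an algorithm that decides for every natural number
whether it is the Gödel number of a formula in the set. -/
def DecidableSet {A : Type u} {P : Type v} {ck : Bool} [Fintype A] [DecidableEq A]
    [Encodable P] (L : Set (Form A P ck)) : Prop :=
  ComputablePred fun n : ℕ => ∃ φ : Form A P ck, φ ∈ L ∧ φ.code = n

end EpistemicLogic

/-! ### Soundness -/

namespace EpistemicLogic

open Form

variable {A : Type u} {P : Type v} {ck : Bool}

/-! Soundness is checked axiom by axiom. The flag `ck` lets one argument serve both proof systems.

For the converse, fix a set `S` of formulas, finite and closed under subformulas, containing all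
comparisons. Maximal consistent sets are replaced by their traces on `S`, called types. Two types
are related for `B` (`TypeRel`) if they agree on everything that any group `C` with `B ⪯ C` must
know. Types with these relations need not form a model: the relation for `B` need not be the
intersection of those of its members, and a comparison may hold by accident. `Hintikka` records the
conditions on a system of types that are nevertheless enough.

Any such system unravels into a tree of paths (`treeModel`), each step labelled by a group. Agent
`a` cannot notice a step labelled `E` if `E ⪯ {a}` belongs to the type where the step begins; two
paths look alike to `a` if deleting the final steps unnoticed by `a` leaves the same path. As paths
form a tree, looking alike to all members of `B` amounts to having the same root for `B`
(`pathRoot_eq`), and a comparison outside a type is refuted by a step that does not change the type.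
This gives the truth lemma `sat_treeModel`.

Types of maximal consistent sets satisfy the conditions (`hintikka_of_maxConsistent`); the common
knowledge condition is the one that needs the induction axiom. Hence an unprovable formula fails in
a tree. For decidability, a formula is not valid exactly when a Hintikka system of bounded size has
a type without it. The tree itself is infinite, but the search runs over the finite systems, coded
by binary digits, and is primitive recursive. -/

theorem Model.sat_imp (M : Model.{u, v, w} A P) (s : M.State) (φ ψ : Form A P ck) :
    M.Sat s (imp φ ψ) ↔ (M.Sat s φ → M.Sat s ψ) := by
  simp [imp, Model.Sat]

theorem Model.sat_conj (M : Model.{u, v, w} A P) (s : M.State) :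
    ∀ l : List (Form A P ck), M.Sat s (conj l) ↔ ∀ φ ∈ l, M.Sat s φ
  | [] => by simp [conj, top, Model.Sat]
  | [φ] => by simp [conj]
  | φ :: ψ :: l => by
    rw [conj, Model.Sat, M.sat_conj s (ψ :: l)]
    simp

theorem Model.sat_everyKnows (M : Model.{u, v, w} A P) (s : M.State) (B : Finset A)
    (φ : Form A P ck) :
    M.Sat s (everyKnows B φ) ↔ ∀ b ∈ B, ∀ t, M.sim b s t → M.Sat t φ := by
  simp [everyKnows, M.sat_conj, know, Model.Sat, Model.distRel]

theorem Model.distRel_refl (M : Model.{u, v, w} A P) (B : Finset A) (s : M.State) :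
    M.distRel B s s := fun b _ => (M.sim_equiv b).refl s

theorem Model.distRel_symm (M : Model.{u, v, w} A P) {B : Finset A} {s t : M.State}
    (h : M.distRel B s t) : M.distRel B t s := fun b hb => (M.sim_equiv b).symm (h b hb)

theorem Model.distRel_trans (M : Model.{u, v, w} A P) {B : Finset A} {r s t : M.State}
    (h : M.distRel B r s) (h' : M.distRel B s t) : M.distRel B r t :=
  fun b hb => (M.sim_equiv b).trans (h b hb) (h' b hb)

/-- Soundness of both proof systems. -/
theorem Provable.valid [DecidableEq A] {φ : Form A P ck} (h : Provable φ) :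
    Valid.{u, v, w} φ := by
  intro M s
  induction h generalizing s with
  | taut h => exact h (M.Sat s) (fun _ => Iff.rfl) (fun _ _ => Iff.rfl)
  | modusPonens _ _ ih₁ ih₂ => exact (M.sat_imp s _ _).1 (ih₁ s) (ih₂ s)
  | distNec B _ ih => exact fun t _ => ih t
  | distDistribution B φ ψ =>
    simp only [M.sat_imp, Model.Sat]
    exact fun h h' t ht => h t ht (h' t ht)
  | veracity B φ =>
    simp only [M.sat_imp, Model.Sat]
    exact fun h => h s (M.distRel_refl B s)
  | posIntrospection B φ =>
    simp only [M.sat_imp, Model.Sat]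
    exact fun h t ht r hr => h r (M.distRel_trans ht hr)
  | negIntrospection B φ =>
    simp only [M.sat_imp, Model.Sat]
    exact fun h t ht h' => h fun r hr => h' r (M.distRel_trans (M.distRel_symm ht) hr)
  | inclusion h => exact fun t ht b hb => ht b (h hb)
  | additivity B C E =>
    simp only [M.sat_imp, Model.Sat]
    intro h t ht b hb
    rcases Finset.mem_union.1 hb with hb | hb
    · exact h.1 t ht b hb
    · exact h.2 t ht b hb
  | transitivity B C E =>
    simp only [M.sat_imp, Model.Sat]
    exact fun h t ht => h.2 t (h.1 t ht)
  | knownSuperiority B C =>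
    simp only [M.sat_imp, Model.Sat]
    exact fun h t ht r hr => M.distRel_trans (M.distRel_symm (h t ht)) (h r (M.distRel_trans ht hr))
  | knowledgeTransfer B C φ =>
    simp only [M.sat_imp, Model.Sat]
    exact fun h h' t ht => h' t (h t ht)
  | commonNec h B _ ih => exact fun t _ => ih t
  | commonDistribution h B φ ψ =>
    simp only [M.sat_imp, Model.Sat]
    exact fun h h' t ht => h t ht (h' t ht)
  | commonFixedPoint h B φ =>
    simp only [M.sat_imp, Model.Sat, M.sat_everyKnows]
    exact fun h => ⟨h s .refl, fun b hb t ht r hr => h r (.head ⟨b, hb, ht⟩ hr)⟩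
  | commonInduction h B φ =>
    simp only [M.sat_imp, Model.Sat, M.sat_everyKnows]
    intro h h' t ht
    induction ht with
    | refl => exact h'
    | tail hr hstep ih =>
      obtain ⟨b, hb, hsim⟩ := hstep
      exact h _ hr ih b hb _ hsim

/-! ### Maximal consistent sets -/

section Canonical

variable [DecidableEq A]

/-- Derivability from a set of assumptions, without necessitation of the assumptions. -/
inductive Derives (Γ : Set (Form A P ck)) : Form A P ck → Prop
  | assumption {φ : Form A P ck} (h : φ ∈ Γ) : Derives Γ φ
  | thm {φ : Form A P ck} (h : Provable φ) : Derives Γ φ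
  | mp {φ ψ : Form A P ck} (h₁ : Derives Γ (imp φ ψ)) (h₂ : Derives Γ φ) : Derives Γ ψ

namespace Derives

theorem mono {Γ Δ : Set (Form A P ck)} (hΓ : Γ ⊆ Δ) {φ : Form A P ck} (h : Derives Γ φ) :
    Derives Δ φ := by
  induction h with
  | assumption h => exact .assumption (hΓ h)
  | thm h => exact .thm h
  | mp _ _ ih₁ ih₂ => exact .mp ih₁ ih₂

theorem provable {φ : Form A P ck} (h : Derives ∅ φ) : Provable φ := by
  induction h with
  | assumption h => exact h.elim
  | thm h => exact h
  | mp _ _ ih₁ ih₂ => exact .modusPonens ih₁ ih₂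

theorem taut {Γ : Set (Form A P ck)} {φ : Form A P ck} (h : Tautology φ) : Derives Γ φ :=
  .thm (.taut h)

/-- The deduction theorem. -/
theorem deduction {Γ : Set (Form A P ck)} {φ ψ : Form A P ck} (h : Derives (insert φ Γ) ψ) :
    Derives Γ (imp φ ψ) := by
  induction h with
  | @assumption χ h =>
    rcases h with rfl | h
    · exact taut fun v hn ha => by simp only [imp, hn, ha]; tauto
    · refine .mp (taut (φ := imp χ (imp φ χ)) ?_) (.assumption h)
      exact fun v hn ha => by simp only [imp, hn, ha]; tauto
  | @thm χ h =>
    refine .mp (taut (φ := imp χ (imp φ χ)) ?_) (.thm h)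
    exact fun v hn ha => by simp only [imp, hn, ha]; tauto
  | @mp χ θ _ _ ih₁ ih₂ =>
    refine .mp (.mp (taut (φ := imp (imp φ (imp χ θ)) (imp (imp φ χ) (imp φ θ))) ?_) ih₁) ih₂
    exact fun v hn ha => by simp only [imp, hn, ha]; tauto

/-- A derivation uses the assumptions of one member of a chain only. -/
theorem exists_of_sUnion {c : Set (Set (Form A P ck))} (hc : IsChain (· ⊆ ·) c)
    (hne : c.Nonempty) {φ : Form A P ck} (h : Derives (⋃₀ c) φ) : ∃ Γ ∈ c, Derives Γ φ := by
  induction h with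
  | assumption h =>
    obtain ⟨Γ, hΓ, h⟩ := h
    exact ⟨Γ, hΓ, .assumption h⟩
  | thm h => exact ⟨_, hne.some_mem, .thm h⟩
  | mp _ _ ih₁ ih₂ =>
    obtain ⟨Γ, hΓ, h₁⟩ := ih₁
    obtain ⟨Δ, hΔ, h₂⟩ := ih₂
    rcases hc.total hΓ hΔ with h | h
    · exact ⟨Δ, hΔ, .mp (h₁.mono h) h₂⟩
    · exact ⟨Γ, hΓ, .mp h₁ (h₂.mono h)⟩

end Derives

/-- Maximal consistent sets. -/
structure MaxConsistent (Γ : Set (Form A P ck)) : Prop where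
  mem_of_provable : ∀ {φ}, Provable φ → φ ∈ Γ
  mp : ∀ {φ ψ}, imp φ ψ ∈ Γ → φ ∈ Γ → ψ ∈ Γ
  neg_mem : ∀ {φ}, neg φ ∈ Γ ↔ φ ∉ Γ

/-- Lindenbaum's lemma. -/
theorem exists_maxConsistent {Γ : Set (Form A P ck)} {φ : Form A P ck} (h : ¬ Derives Γ φ) :
    ∃ Δ, Γ ⊆ Δ ∧ MaxConsistent Δ ∧ φ ∉ Δ := by
  obtain ⟨Δ, hΓ, hmax⟩ := zorn_subset_nonempty {Δ : Set (Form A P ck) | ¬ Derives Δ φ}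
    (fun c hc hchain hne => ⟨⋃₀ c, fun hd => by
      obtain ⟨Δ, hΔ, hd⟩ := Derives.exists_of_sUnion hchain hne hd
      exact hc hΔ hd, fun Δ hΔ => Set.subset_sUnion_of_mem hΔ⟩) Γ h
  have hΔ : ¬ Derives Δ φ := hmax.prop
  have hins : ∀ {χ}, χ ∉ Δ → Derives Δ (imp χ φ) := fun {χ} hχ => by
    by_contra hd
    exact hχ (hmax.le_of_ge (y := insert χ Δ) (fun h' => hd h'.deduction)
      (Set.subset_insert χ Δ) (Set.mem_insert χ Δ))
  have hcl : ∀ {χ}, Derives Δ χ → χ ∈ Δ := fun {χ} hχ => by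
    by_contra hn
    exact hΔ (.mp (hins hn) hχ)
  refine ⟨Δ, hΓ, ⟨fun h => hcl (.thm h), fun h₁ h₂ => hcl (.mp (.assumption h₁) (.assumption h₂)),
    fun {χ} => ⟨fun h₁ h₂ => hΔ ?_, fun h₁ => ?_⟩⟩, fun h => hΔ (.assumption h)⟩
  · refine .mp (.mp (.taut (φ := imp χ (imp (neg χ) φ)) ?_) (.assumption h₂)) (.assumption h₁)
    exact fun v hn ha => by simp only [imp, hn, ha]; tauto
  · by_contra h₂
    refine hΔ (.mp (.mp (.taut (φ := imp (imp χ φ) (imp (imp (neg χ) φ) φ)) ?_) (hins h₁))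
      (hins h₂))
    exact fun v hn ha => by simp only [imp, hn, ha]; tauto

theorem exists_maxConsistent_of_not_provable {φ : Form A P ck} (h : ¬ Provable φ) :
    ∃ Δ, MaxConsistent Δ ∧ φ ∉ Δ := by
  obtain ⟨Δ, -, h⟩ := exists_maxConsistent (Γ := ∅) fun h' : Derives ∅ φ => h h'.provable
  exact ⟨Δ, h⟩

theorem provable_of_forall_mem {φ : Form A P ck}
    (h : ∀ Γ : Set (Form A P ck), MaxConsistent Γ → φ ∈ Γ) : Provable φ := by
  by_contra hn
  obtain ⟨Γ, hΓ, hφ⟩ := exists_maxConsistent_of_not_provable hn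
  exact hφ (h Γ hΓ)

namespace MaxConsistent

variable {Γ Δ : Set (Form A P ck)}

theorem and_mem (hΓ : MaxConsistent Γ) {φ ψ : Form A P ck} :
    and φ ψ ∈ Γ ↔ φ ∈ Γ ∧ ψ ∈ Γ := by
  refine ⟨fun h => ⟨?_, ?_⟩, fun h => ?_⟩
  · refine hΓ.mp (hΓ.mem_of_provable (.taut (φ := imp (and φ ψ) φ) ?_)) h
    exact fun v hn ha => by simp only [imp, hn, ha]; tauto
  · refine hΓ.mp (hΓ.mem_of_provable (.taut (φ := imp (and φ ψ) ψ) ?_)) h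
    exact fun v hn ha => by simp only [imp, hn, ha]; tauto
  · refine hΓ.mp (hΓ.mp (hΓ.mem_of_provable
      (.taut (φ := imp φ (imp ψ (and φ ψ))) ?_)) h.1) h.2
    exact fun v hn ha => by simp only [imp, hn, ha]; tauto

theorem imp_mem (hΓ : MaxConsistent Γ) {φ ψ : Form A P ck} :
    imp φ ψ ∈ Γ ↔ (φ ∈ Γ → ψ ∈ Γ) := by
  rw [imp, hΓ.neg_mem, hΓ.and_mem, hΓ.neg_mem]
  tauto

theorem conj_mem (hΓ : MaxConsistent Γ) :
    ∀ l : List (Form A P ck), conj l ∈ Γ ↔ ∀ φ ∈ l, φ ∈ Γ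
  | [] => by simpa [conj, top] using hΓ.mem_of_provable (.inclusion subset_rfl)
  | [φ] => by simp [conj]
  | φ :: ψ :: l => by
    rw [conj, hΓ.and_mem, hΓ.conj_mem (ψ :: l)]
    simp

theorem everyKnows_mem (hΓ : MaxConsistent Γ) {B : Finset A} {φ : Form A P ck} :
    everyKnows B φ ∈ Γ ↔ ∀ b ∈ B, dist {b} φ ∈ Γ := by
  simp [everyKnows, hΓ.conj_mem, know]

theorem of_provable_imp (hΓ : MaxConsistent Γ) {φ ψ : Form A P ck} (h : Provable (imp φ ψ))
    (hφ : φ ∈ Γ) : ψ ∈ Γ := hΓ.mp (hΓ.mem_of_provable h) hφ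

theorem cmp_union (hΓ : MaxConsistent Γ) {B C E : Finset A} (h₁ : Form.cmp B C ∈ Γ)
    (h₂ : Form.cmp B E ∈ Γ) : Form.cmp B (C ∪ E) ∈ Γ :=
  hΓ.of_provable_imp (.additivity B C E) (hΓ.and_mem.2 ⟨h₁, h₂⟩)

theorem cmp_trans (hΓ : MaxConsistent Γ) {B C E : Finset A} (h₁ : Form.cmp B C ∈ Γ)
    (h₂ : Form.cmp C E ∈ Γ) : Form.cmp B E ∈ Γ :=
  hΓ.of_provable_imp (.transitivity B C E) (hΓ.and_mem.2 ⟨h₁, h₂⟩)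

theorem dist_of_cmp (hΓ : MaxConsistent Γ) {B C : Finset A} {φ : Form A P ck}
    (h₁ : Form.cmp B C ∈ Γ) (h₂ : dist C φ ∈ Γ) : dist B φ ∈ Γ :=
  hΓ.mp (hΓ.of_provable_imp (.knowledgeTransfer B C φ) h₁) h₂

/-- The canonical accessibility relation of `D_B`. -/
def Access (B : Finset A) (Γ Δ : Set (Form A P ck)) : Prop := ∀ φ, dist B φ ∈ Γ → φ ∈ Δ

theorem access_of_cmp (hΓ : MaxConsistent Γ) {B C : Finset A} (h : Form.cmp B C ∈ Γ)
    (hB : Access B Γ Δ) : Access C Γ Δ := fun φ hφ => hB φ (hΓ.dist_of_cmp h hφ)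

theorem dist_mem_iff (hΓ : MaxConsistent Γ) (hΔ : MaxConsistent Δ) {B : Finset A}
    (h : Access B Γ Δ) {φ : Form A P ck} : dist B φ ∈ Γ ↔ dist B φ ∈ Δ := by
  refine ⟨fun hφ => h _ (hΓ.of_provable_imp (.posIntrospection B φ) hφ), fun hφ => ?_⟩
  by_contra hn
  exact hΔ.neg_mem.1 (h _ (hΓ.of_provable_imp (.negIntrospection B φ) (hΓ.neg_mem.2 hn))) hφ

theorem access_symm (hΓ : MaxConsistent Γ) (hΔ : MaxConsistent Δ) {B : Finset A}
    (h : Access B Γ Δ) : Access B Δ Γ := fun _ hφ =>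
  hΓ.of_provable_imp (.veracity B _) ((hΓ.dist_mem_iff hΔ h).2 hφ)

theorem cmp_mem_iff (hΓ : MaxConsistent Γ) (hΔ : MaxConsistent Δ) {B C : Finset A}
    (h : Access B Γ Δ) : Form.cmp B C ∈ Γ ↔ Form.cmp B C ∈ Δ :=
  ⟨fun hc => h _ (hΓ.of_provable_imp (.knownSuperiority B C) hc), fun hc =>
    hΓ.access_symm hΔ h _ (hΔ.of_provable_imp (.knownSuperiority B C) hc)⟩

theorem common_elim (hΓ : MaxConsistent Γ) {hc : ck = true} {B : Finset A} {φ : Form A P ck}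
    (h : common hc B φ ∈ Γ) : φ ∈ Γ :=
  (hΓ.and_mem.1 (hΓ.of_provable_imp (.commonFixedPoint hc B φ) h)).1

/-- The fixed point axiom gives `K_b C_B φ`, and `C ⪯ {b}` by inclusion transfers this knowledge to
`C`. One shared agent therefore suffices to carry `C_B φ` along a step for `C`. -/
theorem common_mem_of_access (hΓ : MaxConsistent Γ) {hc : ck = true} {B C : Finset A} {b : A}
    (hbC : b ∈ C) (hbB : b ∈ B) (h : Access C Γ Δ) {φ : Form A P ck}
    (hφ : common hc B φ ∈ Γ) : common hc B φ ∈ Δ := by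
  have hk := (hΓ.and_mem.1 (hΓ.of_provable_imp (.commonFixedPoint hc B φ) hφ)).2
  refine h _ (hΓ.dist_of_cmp (hΓ.mem_of_provable (.inclusion ?_)) (hΓ.everyKnows_mem.1 hk b hbB))
  simpa using hbC

/-- The existence lemma for distributed knowledge. -/
theorem exists_access (hΓ : MaxConsistent Γ) {B : Finset A} {φ : Form A P ck}
    (h : dist B φ ∉ Γ) : ∃ Δ, MaxConsistent Δ ∧ Access B Γ Δ ∧ φ ∉ Δ := by
  -- Necessitation is never applied to the assumptions, so `D_B` can be pushed through a derivation
  -- by distribution alone.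
  have key : ∀ {ψ}, Derives {χ | dist B χ ∈ Γ} ψ → dist B ψ ∈ Γ := by
    intro ψ hψ
    induction hψ with
    | assumption h => exact h
    | thm h => exact hΓ.mem_of_provable (.distNec B h)
    | mp _ _ ih₁ ih₂ => exact hΓ.mp (hΓ.of_provable_imp (.distDistribution B _ _) ih₁) ih₂
  obtain ⟨Δ, hsub, hΔ, hφ⟩ := exists_maxConsistent (Γ := {χ | dist B χ ∈ Γ}) fun hd => h (key hd)
  exact ⟨Δ, hΔ, fun χ hχ => hsub hχ, hφ⟩

end MaxConsistent

end Canonical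

end EpistemicLogic

/-! ### Types and Hintikka systems -/

namespace EpistemicLogic

open Form

variable {A : Type u} {P : Type v} {ck : Bool}

/-- The formulas that, at every state of a model, the group `C` either distributedly knows to be
true or distributedly knows to be false by virtue of their shape. -/
def KnownTo (C : Finset A) : Form A P ck → Prop
  | .dist B _ => B = C
  | .cmp B _ => B = C
  | .common _ B _ => ∃ c ∈ C, c ∈ B
  | _ => False

/-- The relation for `D_B` between types over the set `S` of formulas. -/
def TypeRel (S : Set (Form A P ck)) (B : Finset A) (X Y : Set (Form A P ck)) : Prop :=
  ∀ C, Form.cmp B C ∈ X → ∀ ψ ∈ S, KnownTo C ψ → (ψ ∈ X ↔ ψ ∈ Y)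

/-- Sets of formulas that are closed under subformulas and contain all comparisons. -/
structure SubClosed (S : Set (Form A P ck)) : Prop where
  neg_sub : ∀ {φ}, neg φ ∈ S → φ ∈ S
  and_sub : ∀ {φ ψ}, Form.and φ ψ ∈ S → φ ∈ S ∧ ψ ∈ S
  dist_sub : ∀ {B φ}, Form.dist B φ ∈ S → φ ∈ S
  common_sub : ∀ {h B φ}, common h B φ ∈ S → φ ∈ S
  cmp_mem : ∀ B C, Form.cmp B C ∈ S

/-- Every formula lies in a finite set that is closed under subformulas and contains
all comparisons. -/
theorem exists_finite_subClosed [Finite A] (φ : Form A P ck) :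
    ∃ S : Set (Form A P ck), S.Finite ∧ SubClosed S ∧ φ ∈ S := by
  have hfin : (Set.range fun p : Finset A × Finset A => (Form.cmp p.1 p.2 : Form A P ck)).Finite :=
    Set.finite_range _
  induction φ with
  | atom p =>
    refine ⟨_, hfin.insert (atom p), ?_, Set.mem_insert _ _⟩
    constructor <;> simp
  | neg φ ih =>
    obtain ⟨S, hS, hc, hφ⟩ := ih
    refine ⟨_, hS.insert (neg φ), ?_, Set.mem_insert _ _⟩
    constructor <;> intros <;> simp_all [Set.mem_insert_iff] <;>
      grind [SubClosed]
  | and φ ψ ih₁ ih₂ =>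
    obtain ⟨S, hS, hc, hφ⟩ := ih₁
    obtain ⟨T, hT, hc', hψ⟩ := ih₂
    refine ⟨_, (hS.union hT).insert (Form.and φ ψ), ?_, Set.mem_insert _ _⟩
    constructor <;> intros <;> simp_all [Set.mem_insert_iff] <;>
      grind [SubClosed]
  | dist B φ ih =>
    obtain ⟨S, hS, hc, hφ⟩ := ih
    refine ⟨_, hS.insert (Form.dist B φ), ?_, Set.mem_insert _ _⟩
    constructor <;> intros <;> simp_all [Set.mem_insert_iff] <;>
      grind [SubClosed]
  | cmp B C =>
    refine ⟨_, hfin, ?_, ⟨(B, C), rfl⟩⟩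
    constructor <;> simp
  | common h B φ ih =>
    obtain ⟨S, hS, hc, hφ⟩ := ih
    refine ⟨_, hS.insert (common h B φ), ?_, Set.mem_insert _ _⟩
    constructor <;> intros <;> simp_all [Set.mem_insert_iff] <;>
      grind [SubClosed]

/-- Systems of types over `S` in which every failure of a modal formula has a witness. -/
structure Hintikka [DecidableEq A] (S : Set (Form A P ck)) {W : Type w}
    (mem : W → Set (Form A P ck)) : Prop where
  neg_mem : ∀ w φ, neg φ ∈ S → (neg φ ∈ mem w ↔ φ ∉ mem w)
  and_mem : ∀ w φ ψ, Form.and φ ψ ∈ S → (Form.and φ ψ ∈ mem w ↔ φ ∈ mem w ∧ ψ ∈ mem w)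
  cmp_of_subset : ∀ w B C, C ⊆ B → Form.cmp B C ∈ mem w
  cmp_union : ∀ w B C E, Form.cmp B C ∈ mem w → Form.cmp B E ∈ mem w → Form.cmp B (C ∪ E) ∈ mem w
  cmp_trans : ∀ w B C E, Form.cmp B C ∈ mem w → Form.cmp C E ∈ mem w → Form.cmp B E ∈ mem w
  dist_elim : ∀ w B φ, Form.dist B φ ∈ S → Form.dist B φ ∈ mem w → φ ∈ mem w
  dist_witness : ∀ w B φ, Form.dist B φ ∈ S → Form.dist B φ ∉ mem w →
    ∃ w', TypeRel S B (mem w) (mem w') ∧ φ ∉ mem w'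
  common_elim : ∀ w h B φ, common h B φ ∈ S → common h B φ ∈ mem w → φ ∈ mem w
  common_witness : ∀ w h B φ, common h B φ ∈ S → common h B φ ∉ mem w → ∀ Z : Set W, w ∈ Z →
    (∀ b ∈ B, ∀ x ∈ Z, ∀ y, TypeRel S {b} (mem x) (mem y) → y ∈ Z) → ∃ x ∈ Z, φ ∉ mem x

namespace TypeRel

variable {S X Y Z : Set (Form A P ck)} {B C : Finset A}

theorem refl (S : Set (Form A P ck)) (B : Finset A) (X : Set (Form A P ck)) :
    TypeRel S B X X := fun _ _ _ _ _ => Iff.rfl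

theorem cmp_mem_iff (hS : SubClosed S) (hBB : Form.cmp B B ∈ X) (h : TypeRel S B X Y) :
    Form.cmp B C ∈ X ↔ Form.cmp B C ∈ Y :=
  h B hBB _ (hS.cmp_mem B C) rfl

/-- The definition reads the comparisons in `X` only. Since `B ⪯ B` is in `X`, the comparisons `B ⪯
C` are themselves among the formulas on which `X` and `Y` agree. -/
theorem symm (hS : SubClosed S) (hBB : Form.cmp B B ∈ X) (h : TypeRel S B X Y) :
    TypeRel S B Y X := fun C hC ψ hψ hk =>
  (h C ((h.cmp_mem_iff hS hBB).2 hC) ψ hψ hk).symm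

theorem trans (hS : SubClosed S) (hBB : Form.cmp B B ∈ X) (h : TypeRel S B X Y)
    (h' : TypeRel S B Y Z) : TypeRel S B X Z := fun C hC ψ hψ hk =>
  (h C hC ψ hψ hk).trans (h' C ((h.cmp_mem_iff hS hBB).1 hC) ψ hψ hk)

end TypeRel

section Canonical

variable [DecidableEq A]

theorem MaxConsistent.mem_iff_of_knownTo {Γ Δ : Set (Form A P ck)} (hΓ : MaxConsistent Γ)
    (hΔ : MaxConsistent Δ) {C : Finset A} (h : MaxConsistent.Access C Γ Δ) {ψ : Form A P ck}
    (hψ : KnownTo C ψ) : ψ ∈ Γ ↔ ψ ∈ Δ := by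
  cases ψ with
  | atom p => exact hψ.elim
  | neg φ => exact hψ.elim
  | and φ ψ => exact hψ.elim
  | dist B φ => obtain rfl : B = C := hψ; exact hΓ.dist_mem_iff hΔ h
  | cmp B E => obtain rfl : B = C := hψ; exact hΓ.cmp_mem_iff hΔ h
  | common hc B φ =>
    obtain ⟨c, hcC, hcB⟩ := hψ
    exact ⟨hΓ.common_mem_of_access hcC hcB h,
      hΔ.common_mem_of_access hcC hcB (hΓ.access_symm hΔ h)⟩

/-- A property of the types over a finite set of formulas is expressed by a formula. -/
theorem exists_characteristic {S : Set (Form A P ck)} (hS : S.Finite) :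
    ∀ Q : Set (Form A P ck) → Prop,
      ∃ χ, ∀ Γ : Set (Form A P ck), MaxConsistent Γ → (χ ∈ Γ ↔ Q (Γ ∩ S)) := by
  induction S, hS using Set.Finite.induction_on with
  | empty =>
    intro Q
    by_cases hQ : Q ∅
    · exact ⟨Form.cmp ∅ ∅, fun Γ hΓ => by
        simpa [hQ] using hΓ.mem_of_provable (.inclusion subset_rfl)⟩
    · exact ⟨neg (Form.cmp ∅ ∅), fun Γ hΓ => by
        simpa [hQ, hΓ.neg_mem] using hΓ.mem_of_provable (.inclusion subset_rfl)⟩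
  | @insert σ S hσ _ ih =>
    intro Q
    obtain ⟨χ₁, h₁⟩ := ih fun X => Q (insert σ X)
    obtain ⟨χ₀, h₀⟩ := ih Q
    -- Split on `σ`: `χ₁` decides the types that contain `σ`, `χ₀` those that do not.
    refine ⟨and (imp σ χ₁) (imp (neg σ) χ₀), fun Γ hΓ => ?_⟩
    rw [hΓ.and_mem, hΓ.imp_mem, hΓ.imp_mem, hΓ.neg_mem, h₁ Γ hΓ, h₀ Γ hΓ]
    by_cases hm : σ ∈ Γ
    · simp [hm, Set.inter_insert_of_mem]
    · simp [hm, Set.inter_insert_of_notMem]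

/-- The types over a finite set of formulas that are realised by maximal consistent sets form
a Hintikka system. -/
theorem hintikka_of_maxConsistent {S : Set (Form A P ck)} (hfin : S.Finite) (hS : SubClosed S)
    {W : Type w} {mem : W → Set (Form A P ck)}
    (hmem : ∀ w, ∃ Γ, MaxConsistent Γ ∧ mem w ∩ S = Γ ∩ S)
    (hsurj : ∀ Γ, MaxConsistent Γ → ∃ w, mem w ∩ S = Γ ∩ S) : Hintikka S mem := by
  have tr : ∀ {X Y : Set (Form A P ck)}, X ∩ S = Y ∩ S → ∀ {φ}, φ ∈ S → (φ ∈ X ↔ φ ∈ Y) := by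
    intro X Y h φ hφ
    have := Set.ext_iff.1 h φ
    simpa [hφ] using this
  have rel : ∀ {X Y Γ Δ : Set (Form A P ck)} {B : Finset A}, MaxConsistent Γ → MaxConsistent Δ →
      X ∩ S = Γ ∩ S → Y ∩ S = Δ ∩ S → MaxConsistent.Access B Γ Δ → TypeRel S B X Y := by
    intro X Y Γ Δ B hΓ hΔ hX hY h C hC ψ hψ hk
    rw [tr hX hψ, tr hY hψ]
    exact hΓ.mem_iff_of_knownTo hΔ
      (hΓ.access_of_cmp ((tr hX (hS.cmp_mem B C)).1 hC) h) hk
  constructor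
  · intro w φ hφ
    obtain ⟨Γ, hΓ, h⟩ := hmem w
    rw [tr h hφ, tr h (hS.neg_sub hφ), hΓ.neg_mem]
  · intro w φ ψ hφ
    obtain ⟨Γ, hΓ, h⟩ := hmem w
    rw [tr h hφ, tr h (hS.and_sub hφ).1, tr h (hS.and_sub hφ).2, hΓ.and_mem]
  · intro w B C hBC
    obtain ⟨Γ, hΓ, h⟩ := hmem w
    exact (tr h (hS.cmp_mem B C)).2 (hΓ.mem_of_provable (.inclusion hBC))
  · intro w B C E
    obtain ⟨Γ, hΓ, h⟩ := hmem w
    rw [tr h (hS.cmp_mem _ _), tr h (hS.cmp_mem _ _), tr h (hS.cmp_mem _ _)]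
    exact hΓ.cmp_union
  · intro w B C E
    obtain ⟨Γ, hΓ, h⟩ := hmem w
    rw [tr h (hS.cmp_mem _ _), tr h (hS.cmp_mem _ _), tr h (hS.cmp_mem _ _)]
    exact hΓ.cmp_trans
  · intro w B φ hφ
    obtain ⟨Γ, hΓ, h⟩ := hmem w
    rw [tr h hφ, tr h (hS.dist_sub hφ)]
    exact hΓ.of_provable_imp (.veracity B φ)
  · intro w B φ hφ
    obtain ⟨Γ, hΓ, h⟩ := hmem w
    rw [tr h hφ]
    intro hn
    obtain ⟨Δ, hΔ, hacc, hφΔ⟩ := hΓ.exists_access hn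
    obtain ⟨w', h'⟩ := hsurj Δ hΔ
    exact ⟨w', rel hΓ hΔ h h' hacc, by rwa [tr h' (hS.dist_sub hφ)]⟩
  · intro w hc B φ hφ
    obtain ⟨Γ, hΓ, h⟩ := hmem w
    rw [tr h hφ, tr h (hS.common_sub hφ)]
    exact hΓ.common_elim
  · intro w hc B φ hφ hn Z hwZ hZ
    by_contra! hall
    obtain ⟨Γ, hΓ, h⟩ := hmem w
    rw [tr h hφ] at hn
    -- Here `χ` says that the present type occurs in `Z`. Closure of `Z` makes `χ → ⋀ K_b χ`
    -- provable, and `χ → φ` is provable if no member of `Z` omits `φ`; the induction axiom then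
    -- yields `C_B φ`, a contradiction.
    obtain ⟨χ, hχ⟩ := exists_characteristic hfin fun X => ∃ x ∈ Z, mem x ∩ S = X
    have hχφ : Provable (imp χ φ) := provable_of_forall_mem fun Δ hΔ => by
      rw [hΔ.imp_mem, hχ Δ hΔ]
      rintro ⟨x, hx, hxΔ⟩
      exact (tr hxΔ (hS.common_sub hφ)).1 (hall x hx)
    have hstep : Provable (imp χ (everyKnows B χ)) := provable_of_forall_mem fun Δ hΔ => by
      rw [hΔ.imp_mem, hΔ.everyKnows_mem, hχ Δ hΔ]
      rintro ⟨x, hx, hxΔ⟩ b hb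
      by_contra hb'
      obtain ⟨Θ, hΘ, hacc, hχΘ⟩ := hΔ.exists_access hb'
      obtain ⟨y, hy⟩ := hsurj Θ hΘ
      exact hχΘ ((hχ Θ hΘ).2 ⟨y, hZ b hb x hx y (rel hΔ hΘ hxΔ hy hacc), hy⟩)
    have h₁ := hΓ.of_provable_imp (.commonInduction hc B χ)
      (hΓ.mem_of_provable (.commonNec hc B hstep))
    have h₂ := hΓ.of_provable_imp (.commonDistribution hc B χ φ)
      (hΓ.mem_of_provable (.commonNec hc B hχφ))
    exact hn (hΓ.mp h₂ (hΓ.mp h₁ ((hχ Γ hΓ).2 ⟨w, hwZ, h⟩)))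

end Canonical

end EpistemicLogic

namespace EpistemicLogic

open Form

variable {A : Type u} {P : Type v} {ck : Bool}

/-! ### The tree of paths and the truth lemma -/

section Tree

variable {S : Set (Form A P ck)} {L W : Type w}

open Classical in
/-- The type at the end of a path from `w₀`.  A path is the list of its steps, the last one first;
steps that are not possible leave the type unchanged. -/
noncomputable def pathEnd (S : Set (Form A P ck)) (mem : W → Set (Form A P ck))
    (lab : L → Finset A) (w₀ : W) : List (L × W) → W
  | [] => w₀
  | e :: s =>
    if TypeRel S (lab e.1) (mem (pathEnd S mem lab w₀ s)) (mem e.2) then e.2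
    else pathEnd S mem lab w₀ s

open Classical in
/-- The shortest initial segment of a path that is connected to it by steps along which
the group `B` loses no information. -/
noncomputable def pathRoot (S : Set (Form A P ck)) (mem : W → Set (Form A P ck))
    (lab : L → Finset A) (w₀ : W) (B : Finset A) : List (L × W) → List (L × W)
  | [] => []
  | e :: s =>
    if Form.cmp (lab e.1) B ∈ mem (pathEnd S mem lab w₀ s) then pathRoot S mem lab w₀ B s
    else e :: s

/-- The tree of paths through a Hintikka system. -/
noncomputable def treeModel (S : Set (Form A P ck)) (mem : W → Set (Form A P ck))
    (lab : L → Finset A) (w₀ : W) : Model.{u, v, w} A P where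
  State := List (L × W)
  sim a s t := pathRoot S mem lab w₀ {a} s = pathRoot S mem lab w₀ {a} t
  sim_equiv _ := ⟨fun _ => rfl, Eq.symm, Eq.trans⟩
  val s p := Form.atom p ∈ mem (pathEnd S mem lab w₀ s)

variable {mem : W → Set (Form A P ck)} {lab : L → Finset A} {w₀ : W}

theorem pathEnd_of_typeRel {l : L} {x : W} {s : List (L × W)}
    (h : TypeRel S (lab l) (mem (pathEnd S mem lab w₀ s)) (mem x)) :
    pathEnd S mem lab w₀ ((l, x) :: s) = x := by
  rw [pathEnd, if_pos h]

theorem pathRoot_suffix (B : Finset A) :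
    ∀ s : List (L × W), pathRoot S mem lab w₀ B s <:+ s
  | [] => List.suffix_rfl
  | e :: s => by
    rw [pathRoot]
    split_ifs
    · exact (pathRoot_suffix B s).trans (List.suffix_cons e s)
    · exact List.suffix_rfl

theorem pathEnd_cons (e : L × W) (s : List (L × W)) :
    TypeRel S (lab e.1) (mem (pathEnd S mem lab w₀ s)) (mem (pathEnd S mem lab w₀ (e :: s))) := by
  rw [pathEnd]
  split_ifs with hr
  · exact hr
  · exact TypeRel.refl _ _ _

namespace Hintikka

variable [DecidableEq A]

theorem cmp_self (h : Hintikka S mem) (w : W) (B : Finset A) : Form.cmp B B ∈ mem w :=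
  h.cmp_of_subset w B B subset_rfl

/-- Additivity reduces comparisons to single agents on the right, which is what the relations of
individual agents in the tree can express. -/
theorem cmp_iff_forall (h : Hintikka S mem) (w : W) (B C : Finset A) :
    Form.cmp B C ∈ mem w ↔ ∀ c ∈ C, Form.cmp B {c} ∈ mem w := by
  refine ⟨fun hBC c hc => h.cmp_trans w B C {c} hBC
    (h.cmp_of_subset w C {c} (by simpa using hc)), fun hall => ?_⟩
  induction C using Finset.induction_on with
  | empty => exact h.cmp_of_subset w B ∅ (Finset.empty_subset B)
  | insert c C _ ih =>
    rw [Finset.insert_eq]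
    exact h.cmp_union w B {c} C (hall c (Finset.mem_insert_self c C))
      (ih fun c' hc' => hall c' (Finset.mem_insert_of_mem hc'))

theorem typeRel_of_cmp (h : Hintikka S mem) {w w' : W} {B C : Finset A}
    (hBC : Form.cmp B C ∈ mem w) (hr : TypeRel S B (mem w) (mem w')) :
    TypeRel S C (mem w) (mem w') :=
  fun E hE ψ hψ hk => hr E (h.cmp_trans w B C E hBC hE) ψ hψ hk

/-- Each deleted step has a label `E` with `E ⪯ B` in the type where it begins, so it relates its
two ends for `B`; these links compose. -/
theorem typeRel_pathRoot (h : Hintikka S mem) (hS : SubClosed S) (B : Finset A) :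
    ∀ s : List (L × W), TypeRel S B (mem (pathEnd S mem lab w₀ s))
      (mem (pathEnd S mem lab w₀ (pathRoot S mem lab w₀ B s)))
  | [] => TypeRel.refl _ _ _
  | e :: s => by
    rw [pathRoot]
    split_ifs with he
    · exact ((h.typeRel_of_cmp he (pathEnd_cons e s)).symm hS (h.cmp_self _ B)).trans hS
        (h.cmp_self _ B) (typeRel_pathRoot h hS B s)
    · exact TypeRel.refl _ _ _

/-- A step deleted for `B` has a label `E` with `E ⪯ B`. As `B ⪯ C` persists back along such steps,
`E ⪯ C` follows by transitivity, and the step is deleted for `C` too. -/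
theorem pathRoot_pathRoot (h : Hintikka S mem) (hS : SubClosed S) {B C : Finset A} :
    ∀ s : List (L × W), Form.cmp B C ∈ mem (pathEnd S mem lab w₀ s) →
      pathRoot S mem lab w₀ C (pathRoot S mem lab w₀ B s) = pathRoot S mem lab w₀ C s
  | [] => fun _ => rfl
  | e :: s => fun hBC => by
    rw [pathRoot]
    split_ifs with he
    · have hBC' : Form.cmp B C ∈ mem (pathEnd S mem lab w₀ s) :=
        ((h.typeRel_of_cmp he (pathEnd_cons e s)).cmp_mem_iff hS (h.cmp_self _ B)).2 hBC
      rw [pathRoot_pathRoot h hS s hBC', pathRoot, if_pos (h.cmp_trans _ _ _ _ he hBC')]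
    · rfl

/-- If some `b` noticed the last step, the longer path would be its own root for `b`, hence a suffix
of `t`, which is no longer and different. -/
theorem pathRoot_eq_of_cons (h : Hintikka S mem) {B : Finset A} {e : L × W} {s t : List (L × W)}
    (hne : e :: s ≠ t) (hlen : t.length ≤ (e :: s).length)
    (hr : ∀ b ∈ B, pathRoot S mem lab w₀ {b} (e :: s) = pathRoot S mem lab w₀ {b} t) :
    Form.cmp (lab e.1) B ∈ mem (pathEnd S mem lab w₀ s) := by
  refine (h.cmp_iff_forall _ _ _).2 fun b hb => ?_
  by_contra hn
  have hb' := hr b hb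
  rw [pathRoot, if_neg hn] at hb'
  have hsuf : e :: s <:+ t := hb' ▸ pathRoot_suffix {b} t
  exact hne (hsuf.eq_of_length_le hlen)

/-- If two paths have the same root for every member of a group, then for the group as well. -/
theorem pathRoot_eq (h : Hintikka S mem) {B : Finset A} (s t : List (L × W))
    (hr : ∀ b ∈ B, pathRoot S mem lab w₀ {b} s = pathRoot S mem lab w₀ {b} t) :
    pathRoot S mem lab w₀ B s = pathRoot S mem lab w₀ B t := by
  induction hn : s.length + t.length using Nat.strong_induction_on generalizing s t with
  | _ n ih =>
    by_cases hst : s = t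
    · rw [hst]
    wlog hlen : t.length ≤ s.length generalizing s t
    · exact (this t s (fun b hb => (hr b hb).symm) (by omega) (Ne.symm hst) (by omega)).symm
    match s with
    | [] => exact absurd (List.eq_nil_of_length_eq_zero (by simpa using hlen)).symm hst
    | e :: s =>
      -- The last step of the longer path goes unnoticed by all of `B`, so dropping it changes none
      -- of the roots and shortens the pair.
      have he := h.pathRoot_eq_of_cons hst hlen hr
      have hstep : ∀ C, (∀ c ∈ C, c ∈ B) →
          pathRoot S mem lab w₀ C (e :: s) = pathRoot S mem lab w₀ C s := fun C hC => by
        rw [pathRoot, if_pos (h.cmp_trans _ _ _ _ he (h.cmp_of_subset _ _ _ hC))]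
      rw [hstep B fun _ => id]
      refine ih _ (by simp at hn; omega) s t (fun b hb => ?_) rfl
      rw [← hr b hb, hstep {b} (by simpa using hb)]

theorem typeRel_of_distRel (h : Hintikka S mem) (hS : SubClosed S) {B : Finset A}
    {s t : List (L × W)} (hst : (treeModel S mem lab w₀).distRel B s t) :
    TypeRel S B (mem (pathEnd S mem lab w₀ s)) (mem (pathEnd S mem lab w₀ t)) := by
  have ht := h.typeRel_pathRoot hS B (lab := lab) (w₀ := w₀) t
  rw [← h.pathRoot_eq s t hst] at ht
  have hs := h.typeRel_pathRoot hS B (lab := lab) (w₀ := w₀) s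
  exact hs.trans hS (h.cmp_self _ B) (ht.symm hS (h.cmp_self _ B))

/-- Both paths have the same root for `B`, and the root of each for `c` can be computed from its
root for `B`. -/
theorem distRel_of_cmp (h : Hintikka S mem) (hS : SubClosed S) {B C : Finset A}
    {s t : List (L × W)} (hBC : Form.cmp B C ∈ mem (pathEnd S mem lab w₀ s))
    (hst : (treeModel S mem lab w₀).distRel B s t) :
    (treeModel S mem lab w₀).distRel C s t := by
  intro c hc
  have hBC' := ((h.typeRel_of_distRel hS hst).cmp_mem_iff hS (h.cmp_self _ B)).1 hBC
  change pathRoot S mem lab w₀ {c} s = pathRoot S mem lab w₀ {c} t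
  rw [← h.pathRoot_pathRoot hS s ((h.cmp_iff_forall _ _ _).1 hBC c hc),
    ← h.pathRoot_pathRoot hS t ((h.cmp_iff_forall _ _ _).1 hBC' c hc), h.pathRoot_eq s t hst]

theorem distRel_cons (h : Hintikka S mem) {B : Finset A} {l : L} (hl : lab l = B) (w : W)
    (s : List (L × W)) : (treeModel S mem lab w₀).distRel B s ((l, w) :: s) := by
  intro b hb
  change pathRoot S mem lab w₀ {b} s = pathRoot S mem lab w₀ {b} ((l, w) :: s)
  rw [pathRoot, if_pos (h.cmp_of_subset _ _ _ (by simpa [hl] using hb))]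

/-- The truth lemma for the tree of paths. -/
theorem sat_treeModel (h : Hintikka S mem) (hS : SubClosed S) (hlab : Function.Surjective lab)
    (φ : Form A P ck) (hφ : φ ∈ S) (s : (treeModel S mem lab w₀).State) :
    (treeModel S mem lab w₀).Sat s φ ↔ φ ∈ mem (pathEnd S mem lab w₀ s) := by
  induction φ generalizing s with
  | atom p => exact Iff.rfl
  | neg φ ih => rw [Model.Sat, ih (hS.neg_sub hφ), h.neg_mem _ _ hφ]
  | and φ ψ ih₁ ih₂ =>
    rw [Model.Sat, ih₁ (hS.and_sub hφ).1, ih₂ (hS.and_sub hφ).2, h.and_mem _ _ _ hφ]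
  | dist B φ ih =>
    refine ⟨fun hsat => ?_, fun hmem t hst => ?_⟩
    · by_contra hn
      obtain ⟨w', hr, hw'⟩ := h.dist_witness _ B φ hφ hn
      obtain ⟨l, hl⟩ := hlab B
      have hsat' := (ih (hS.dist_sub hφ) _).1 (hsat _ (h.distRel_cons hl w' s))
      have he : pathEnd S mem lab w₀ ((l, w') :: s) = w' := pathEnd_of_typeRel (by rwa [hl])
      exact hw' (he ▸ hsat')
    · rw [ih (hS.dist_sub hφ)]
      exact h.dist_elim _ B φ hφ
        ((h.typeRel_of_distRel hS hst B (h.cmp_self _ B) _ hφ rfl).1 hmem)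
  | cmp B C =>
    refine ⟨fun hsat => ?_, fun hmem t hst => h.distRel_of_cmp hS hmem hst⟩
    rw [h.cmp_iff_forall]
    intro c hc
    by_contra hn
    change List (L × W) at s
    obtain ⟨l, hl⟩ := hlab B
    -- The refuting path repeats the current type in a step labelled `B`. Agent `c` notices this
    -- step, so the extended path is its own root, too long to be a root of `s`.
    have hroot : pathRoot S mem lab w₀ {c} s = pathRoot S mem lab w₀ {c}
        ((l, pathEnd S mem lab w₀ s) :: s) := hsat _ (h.distRel_cons hl _ s) c hc
    rw [pathRoot, if_neg (by simpa only [hl] using hn)] at hroot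
    have hlen := (pathRoot_suffix (S := S) (mem := mem) (lab := lab) (w₀ := w₀) {c} s).length_le
    simp [hroot] at hlen
  | common hc B φ ih =>
    refine ⟨fun hsat => ?_, fun hmem t hst => ?_⟩
    · by_contra hn
      -- The ends of all paths reachable from `s` form a closed set, since a step labelled `{b}` can
      -- be appended to any of them.
      obtain ⟨x, ⟨t, hst, rfl⟩, hx⟩ := h.common_witness _ hc B φ hφ hn
        {x | ∃ t, (treeModel S mem lab w₀).commonRel B s t ∧ pathEnd S mem lab w₀ t = x}
        ⟨s, .refl, rfl⟩ (by
          rintro b hb _ ⟨t, hst, rfl⟩ y hy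
          obtain ⟨l, hl⟩ := hlab {b}
          refine ⟨(l, y) :: t, hst.tail ⟨b, hb, h.distRel_cons hl y t b (by simp)⟩, ?_⟩
          exact pathEnd_of_typeRel (by rwa [hl]))
      exact hx ((ih (hS.common_sub hφ) t).1 (hsat t hst))
    · rw [ih (hS.common_sub hφ)]
      refine h.common_elim _ hc B φ hφ ?_
      induction hst with
      | refl => exact hmem
      | tail _ hstep ih' =>
        obtain ⟨b, hb, hsim⟩ := hstep
        refine (h.typeRel_of_distRel hS (B := {b}) ?_ {b} (h.cmp_self _ _) _ hφ ⟨b, by simp, hb⟩).1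
          ih'
        intro b' hb'
        rwa [Finset.mem_singleton.1 hb']

end Hintikka

end Tree

/-! ### Completeness -/

variable [DecidableEq A]

theorem Hintikka.comp_equiv {S : Set (Form A P ck)} {W W' : Type*} {mem : W → Set (Form A P ck)}
    (h : Hintikka S mem) (e : W' ≃ W) : Hintikka S (mem ∘ e) where
  neg_mem w := h.neg_mem (e w)
  and_mem w := h.and_mem (e w)
  cmp_of_subset w := h.cmp_of_subset (e w)
  cmp_union w := h.cmp_union (e w)
  cmp_trans w := h.cmp_trans (e w)
  dist_elim w := h.dist_elim (e w)
  dist_witness w B φ hφ hn := by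
    obtain ⟨x, hx⟩ := h.dist_witness (e w) B φ hφ hn
    exact ⟨e.symm x, by simpa using hx⟩
  common_elim w := h.common_elim (e w)
  common_witness w hc B φ hφ hn Z hw hZ := by
    obtain ⟨x, hxZ, hx⟩ := h.common_witness (e w) hc B φ hφ hn (e.symm ⁻¹' Z) (by simpa using hw)
      fun b hb x hxZ y hy => hZ b hb _ hxZ _ (by simpa using hy)
    exact ⟨e.symm x, hxZ, by simpa using hx⟩

/-- A formula that is missing in a type of a small Hintikka system is not valid. -/
theorem Hintikka.not_valid [Finite A] {S : Set (Form A P ck)} (hS : SubClosed S) {W : Type*}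
    [Small.{w} W] {mem : W → Set (Form A P ck)} (h : Hintikka S mem) {φ : Form A P ck}
    (hφ : φ ∈ S) {x : W} (hx : φ ∉ mem x) : ¬ Valid.{u, v, w} φ := by
  intro hv
  have : Small.{w} (Finset A) := Countable.toSmall _
  -- Types and labels are moved into `Type w`, so that the tree lies in the universe over which
  -- validity quantifies.
  have h' := h.comp_equiv (equivShrink W).symm
  have := (h'.sat_treeModel hS (lab := (equivShrink.{w} (Finset A)).symm) (w₀ := equivShrink W x)
    (Equiv.surjective _) φ hφ []).1 (hv _ _)
  rw [pathEnd] at this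
  exact hx (by simpa using this)

/-- Completeness of both proof systems. -/
theorem Valid.provable [Finite A] {φ : Form A P ck} (h : Valid.{u, v, w} φ) : Provable φ := by
  by_contra hn
  obtain ⟨Γ, hΓ, hφΓ⟩ := exists_maxConsistent_of_not_provable hn
  obtain ⟨S, hfin, hS, hφ⟩ := exists_finite_subClosed φ
  let W := {X : Set (Form A P ck) // ∃ Γ, MaxConsistent Γ ∧ X = Γ ∩ S}
  have : Finite W := (hfin.finite_subsets.subset fun X hX => by
    obtain ⟨Γ, -, rfl⟩ := hX
    exact Set.inter_subset_right : Set.Finite {X | ∃ Γ, MaxConsistent Γ ∧ X = Γ ∩ S})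
  have : Small.{w} W := Countable.toSmall _
  have hH : Hintikka S (fun x : W => x.1) := by
    refine hintikka_of_maxConsistent hfin hS (fun x => ?_) fun Γ hΓ => ⟨⟨Γ ∩ S, Γ, hΓ, rfl⟩, ?_⟩
    · obtain ⟨Γ, hΓ, hx⟩ := x.2
      exact ⟨Γ, hΓ, by simp [hx, Set.inter_assoc]⟩
    · simp [Set.inter_assoc]
  exact hH.not_valid hS hφ (x := ⟨Γ ∩ S, Γ, hΓ, rfl⟩) (fun hm => hφΓ hm.1) h

end EpistemicLogic

/-! ### Primitive recursive predicates and bounded quantifiers -/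

namespace EpistemicLogic

section PrimrecLemmas

variable {α : Type*} [Primcodable α]

theorem primrecPred_const (c : Prop) : PrimrecPred fun _ : α => c := by
  classical
  exact Primrec.primrecPred (Primrec.const (decide c))

theorem primrecPred_imp {p q : α → Prop} (hp : PrimrecPred p) (hq : PrimrecPred q) :
    PrimrecPred fun a => p a → q a :=
  (hp.not.or hq).of_eq fun a => by tauto

theorem primrecPred_iff {p q : α → Prop} (hp : PrimrecPred p) (hq : PrimrecPred q) :
    PrimrecPred fun a => p a ↔ q a :=
  ((primrecPred_imp hp hq).and (primrecPred_imp hq hp)).of_eq fun a => by tauto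

/-- The quantifier unrolls into a fixed finite conjunction, so no uniformity in `b` is required.
This covers quantifiers over agents and groups. -/
theorem primrecPred_forall_finite {β : Type*} [Finite β] {p : α → β → Prop}
    (hp : ∀ b, PrimrecPred fun a => p a b) : PrimrecPred fun a => ∀ b, p a b := by
  classical
  have := Fintype.ofFinite β
  have key : ∀ s : Finset β, PrimrecPred fun a => ∀ b ∈ s, p a b := fun s => by
    induction s using Finset.induction_on with
    | empty => exact (primrecPred_const True).of_eq fun a => by simp
    | insert b s _ ih => exact ((hp b).and ih).of_eq fun a => by simp
  exact (key Finset.univ).of_eq fun a => by simp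

theorem primrecPred_exists_finite {β : Type*} [Finite β] {p : α → β → Prop}
    (hp : ∀ b, PrimrecPred fun a => p a b) : PrimrecPred fun a => ∃ b, p a b :=
  (primrecPred_forall_finite fun b => (hp b).not).not.of_eq fun a => by simp

theorem primrecPred_forall_lt {p : α → ℕ → Prop} {f : α → ℕ} (hf : Primrec f)
    (hp : PrimrecPred fun q : α × ℕ => p q.1 q.2) : PrimrecPred fun a => ∀ x < f a, p a x := by
  have h : PrimrecRel fun (x : ℕ) (a : α) => p a x := hp.comp (Primrec.snd.pair Primrec.fst)
  exact (h.forall_mem_list.comp (Primrec.list_range.comp hf) Primrec.id).of_eq fun a => by simp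

theorem primrecPred_exists_lt {p : α → ℕ → Prop} {f : α → ℕ} (hf : Primrec f)
    (hp : PrimrecPred fun q : α × ℕ => p q.1 q.2) : PrimrecPred fun a => ∃ x < f a, p a x :=
  (primrecPred_forall_lt (p := fun a x => ¬ p a x) hf hp.not).not.of_eq fun a => by simp

theorem primrec_two_pow {f : α → ℕ} (hf : Primrec f) : Primrec fun a => 2 ^ f a :=
  (Primrec₂.unpaired'.1 Nat.Primrec.pow).comp (Primrec.const 2) hf

theorem primrecPred_testBit {f g : α → ℕ} (hf : Primrec f) (hg : Primrec g) :
    PrimrecPred fun a => (f a).testBit (g a) = true :=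
  (Primrec.eq.comp (Primrec.nat_mod.comp (Primrec.nat_div.comp hf (primrec_two_pow hg))
    (Primrec.const 2)) (Primrec.const 1)).of_eq fun a => by
      rw [Nat.testBit_eq_decide_div_mod_eq, decide_eq_true_iff]

theorem lt_of_testBit {m t : ℕ} (h : m.testBit t = true) : t < m :=
  (Nat.lt_pow_self one_lt_two).trans_le (Nat.ge_two_pow_of_testBit h)

theorem primrecPred_forall_testBit {p : α → ℕ → Prop} {f : α → ℕ} (hf : Primrec f)
    (hp : PrimrecPred fun q : α × ℕ => p q.1 q.2) :
    PrimrecPred fun a => ∀ t, (f a).testBit t = true → p a t :=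
  (primrecPred_forall_lt (p := fun a t => (f a).testBit t = true → p a t) hf
    (primrecPred_imp (primrecPred_testBit (hf.comp .fst) .snd) hp)).of_eq
    fun _ => ⟨fun h t ht => h t (lt_of_testBit ht) ht, fun h t _ => h t⟩

theorem primrecPred_exists_testBit {p : α → ℕ → Prop} {f : α → ℕ} (hf : Primrec f)
    (hp : PrimrecPred fun q : α × ℕ => p q.1 q.2) :
    PrimrecPred fun a => ∃ t, (f a).testBit t = true ∧ p a t :=
  (primrecPred_forall_testBit (p := fun a x => ¬ p a x) hf hp.not).not.of_eq fun a => by simp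

theorem exists_testBit_iff (n : ℕ) (p : ℕ → Prop) :
    ∃ m < 2 ^ n, ∀ i, m.testBit i = true ↔ i < n ∧ p i := by
  classical
  refine ⟨Nat.ofBits fun i : Fin n => decide (p i), Nat.ofBits_lt_two_pow _, fun i => ?_⟩
  by_cases hi : i < n
  · simp [Nat.testBit_ofBits_lt _ i hi, hi]
  · simp only [hi, false_and, iff_false, Bool.not_eq_true]
    exact Nat.testBit_lt_two_pow
      ((Nat.ofBits_lt_two_pow _).trans_le (Nat.pow_le_pow_right two_pos (not_lt.1 hi)))

end PrimrecLemmas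

open Form

variable {A : Type u} {P : Type v} [Fintype A] [DecidableEq A]

/-! ### Recognising codes of formulas -/

section Codes

variable [Primcodable P]

/-- The condition on a set `s` of numbers that makes its members codes of formulas. -/
def CodeStep (A : Type u) (P : Type v) [Fintype A] [DecidableEq A] [Primcodable P] (s x : ℕ) :
    Prop :=
  (x.unpair.1 = 1 ∧ x.unpair.2 ∈ Set.range (Encodable.encode : P → ℕ)) ∨
  (x.unpair.1 = 2 ∧ s.testBit x.unpair.2 = true) ∨
  (x.unpair.1 = 3 ∧ s.testBit x.unpair.2.unpair.1 = true ∧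
    s.testBit x.unpair.2.unpair.2 = true) ∨
  (∃ B : Finset A, x.unpair.1 = 4 ∧ x.unpair.2.unpair.1 = groupCode B ∧
    s.testBit x.unpair.2.unpair.2 = true) ∨
  (∃ B C : Finset A, x.unpair.1 = 5 ∧ x.unpair.2 = Nat.pair (groupCode B) (groupCode C)) ∨
  (∃ B : Finset A, x.unpair.1 = 6 ∧ x.unpair.2.unpair.1 = groupCode B ∧
    s.testBit x.unpair.2.unpair.2 = true)

/-- The number `s` codes a set of numbers closed under passing to immediate subformulas, which
certifies that `n` can be parsed; all its members are at most `n`. -/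
theorem exists_code_eq_iff (n : ℕ) :
    (∃ φ : Form A P true, φ.code = n) ↔
      ∃ s < 2 ^ (n + 1), s.testBit n = true ∧
        ∀ x < n + 1, s.testBit x = true → CodeStep A P s x := by
  constructor
  · intro hn
    obtain ⟨s, hs, hbit⟩ := exists_testBit_iff (n + 1) fun i => ∃ φ : Form A P true, φ.code = i
    have sub : ∀ {φ : Form A P true} {y x : ℕ}, x < n + 1 → y ≤ x → φ.code = y →
        s.testBit y = true := fun hx hy hφ => (hbit _).2 ⟨hy.trans_lt hx, _, hφ⟩
    refine ⟨s, hs, (hbit n).2 ⟨n.lt_succ_self, hn⟩, fun x hx hxs => ?_⟩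
    obtain ⟨φ, rfl⟩ := ((hbit x).1 hxs).2
    cases φ with
    | atom p => left; simp [Form.code]
    | neg φ =>
      right; left
      simp only [Form.code, Nat.unpair_pair, true_and] at hx ⊢
      exact sub hx (Nat.right_le_pair _ _) rfl
    | and φ ψ =>
      right; right; left
      simp only [Form.code, Nat.unpair_pair, true_and] at hx ⊢
      exact ⟨sub hx ((Nat.left_le_pair _ _).trans (Nat.right_le_pair _ _)) rfl,
        sub hx ((Nat.right_le_pair _ _).trans (Nat.right_le_pair _ _)) rfl⟩
    | dist B φ =>
      right; right; right; left
      simp only [Form.code, Nat.unpair_pair, true_and] at hx ⊢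
      exact ⟨B, rfl, sub hx ((Nat.right_le_pair _ _).trans (Nat.right_le_pair _ _)) rfl⟩
    | cmp B C =>
      right; right; right; right; left
      exact ⟨B, C, by simp [Form.code]⟩
    | common h B φ =>
      right; right; right; right; right
      simp only [Form.code, Nat.unpair_pair, true_and] at hx ⊢
      exact ⟨B, rfl, sub hx ((Nat.right_le_pair _ _).trans (Nat.right_le_pair _ _)) rfl⟩
  · rintro ⟨s, hs, hn, hstep⟩
    suffices ∀ x, s.testBit x = true → ∃ φ : Form A P true, φ.code = x from this n hn
    intro x
    induction x using Nat.strong_induction_on with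
    | _ x ih =>
      intro hx
      have hxn : x < n + 1 := by
        by_contra hlt
        simp [Nat.testBit_lt_two_pow
          (hs.trans_le (Nat.pow_le_pow_right two_pos (not_lt.1 hlt)))] at hx
      have hpair := Nat.pair_unpair x
      -- `Nat.pair 0 b` and `Nat.pair 1 b` can be as small as `b` or close to it; a tag of at least
      -- 2 is ample for strict descent.
      have hlt : 2 ≤ x.unpair.1 → x.unpair.2 < x := fun h2 => by
        conv_rhs => rw [← hpair]
        rw [Nat.pair]
        split_ifs with h
        · nlinarith
        · nlinarith
      have hpair₂ := Nat.pair_unpair x.unpair.2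
      have hl := Nat.unpair_left_le x.unpair.2
      have hr := Nat.unpair_right_le x.unpair.2
      rcases hstep x hxn hx with ⟨h1, p, hp⟩ | ⟨h1, h⟩ | ⟨h1, h, h'⟩ | ⟨B, h1, hB, h⟩ |
        ⟨B, C, h1, h⟩ | ⟨B, h1, hB, h⟩
      · exact ⟨.atom p, by rw [Form.code, hp, ← h1, hpair]⟩
      · obtain ⟨φ, hφ⟩ := ih _ (hlt (by omega)) h
        exact ⟨.neg φ, by rw [Form.code, hφ, ← h1, hpair]⟩
      · have := hlt (by omega)
        obtain ⟨φ, hφ⟩ := ih _ (by omega) h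
        obtain ⟨ψ, hψ⟩ := ih _ (by omega) h'
        exact ⟨.and φ ψ, by rw [Form.code, hφ, hψ, hpair₂, ← h1, hpair]⟩
      · have := hlt (by omega)
        obtain ⟨φ, hφ⟩ := ih _ (by omega) h
        exact ⟨.dist B φ, by rw [Form.code, hφ, ← hB, hpair₂, ← h1, hpair]⟩
      · exact ⟨.cmp B C, by rw [Form.code, ← h, ← h1, hpair]⟩
      · have := hlt (by omega)
        obtain ⟨φ, hφ⟩ := ih _ (by omega) h
        exact ⟨.common rfl B φ, by rw [Form.code, hφ, ← hB, hpair₂, ← h1, hpair]⟩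

theorem primrecPred_codeStep {α : Type*} [Primcodable α] {f g : α → ℕ} (hf : Primrec f)
    (hg : Primrec g) : PrimrecPred fun a => CodeStep A P (f a) (g a) := by
  have h₁ : Primrec fun a => (g a).unpair.1 := Primrec.fst.comp (Primrec.unpair.comp hg)
  have h₂ : Primrec fun a => (g a).unpair.2 := Primrec.snd.comp (Primrec.unpair.comp hg)
  have h₂₁ : Primrec fun a => (g a).unpair.2.unpair.1 := Primrec.fst.comp (Primrec.unpair.comp h₂)
  have h₂₂ : Primrec fun a => (g a).unpair.2.unpair.2 := Primrec.snd.comp (Primrec.unpair.comp h₂)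
  have tag : ∀ {k : α → ℕ} (_ : Primrec k) (i : ℕ), PrimrecPred fun a => k a = i :=
    fun hk i => Primrec.eq.comp hk (Primrec.const i)
  refine .or ((tag h₁ 1).and (Primcodable.mem_range_encode.comp h₂)) <|
    .or ((tag h₁ 2).and (primrecPred_testBit hf h₂)) <|
    .or ((tag h₁ 3).and ((primrecPred_testBit hf h₂₁).and (primrecPred_testBit hf h₂₂))) <|
    .or (primrecPred_exists_finite fun B => ?_) <|
    .or (primrecPred_exists_finite fun B => primrecPred_exists_finite fun C => ?_)
      (primrecPred_exists_finite fun B => ?_)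
  · exact (tag h₁ 4).and ((tag h₂₁ _).and (primrecPred_testBit hf h₂₂))
  · exact (tag h₁ 5).and (tag h₂ _)
  · exact (tag h₁ 6).and ((tag h₂₁ _).and (primrecPred_testBit hf h₂₂))

variable (A P) in
/-- The set of codes of formulas is primitive recursive. -/
theorem primrecPred_exists_code_eq :
    PrimrecPred fun n : ℕ => ∃ φ : Form A P true, φ.code = n := by
  have hs : Primrec fun n : ℕ => n + 1 := Primrec.succ
  refine (primrecPred_exists_lt (primrec_two_pow hs) ?_).of_eq
    fun n => (exists_code_eq_iff (A := A) (P := P) n).symm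
  refine (primrecPred_testBit .snd .fst).and (primrecPred_forall_lt (hs.comp .fst) ?_)
  have hs' : Primrec fun q : (ℕ × ℕ) × ℕ => q.1.2 := Primrec.snd.comp .fst
  exact primrecPred_imp (primrecPred_testBit hs' .snd) (primrecPred_codeStep hs' .snd)

theorem primrecPred_forall_form {α : Type*} [Primcodable α] {p : α → ℕ → Prop} {f : α → ℕ}
    (hf : Primrec f) (hp : PrimrecPred fun q : α × ℕ => p q.1 q.2) :
    PrimrecPred fun a => ∀ φ : Form A P true, φ.code ≤ f a → p a φ.code :=
  (primrecPred_forall_lt (p := fun a x => (∃ φ : Form A P true, φ.code = x) → p a x)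
    (Primrec.succ.comp hf)
    (primrecPred_imp ((primrecPred_exists_code_eq A P).comp .snd) hp)).of_eq fun _ =>
    ⟨fun h φ hφ => h _ (Nat.lt_succ_of_le hφ) ⟨φ, rfl⟩, fun h x hx ⟨φ, hφ⟩ => by
      subst hφ
      exact h φ (Nat.le_of_lt_succ hx)⟩

end Codes

end EpistemicLogic

/-! ### Hintikka systems coded by numbers -/

namespace EpistemicLogic

open Form

variable {A : Type u} {P : Type v} [Fintype A] [DecidableEq A]

section Encodable

variable [Encodable P]

/-- The formulas whose code is at most `N`. -/
def codeBelow (A : Type u) (P : Type v) [Fintype A] [DecidableEq A] [Encodable P] (N : ℕ) :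
    Set (Form A P true) := {φ | φ.code ≤ N}

/-- The set of formulas that is given by the binary digits of a number. -/
def bitType (A : Type u) (P : Type v) [Fintype A] [DecidableEq A] [Encodable P] (t : ℕ) :
    Set (Form A P true) := {φ | t.testBit φ.code = true}

/-- The system of types that is given by the binary digits of a number. -/
def bitSystem (A : Type u) (P : Type v) [Fintype A] [DecidableEq A] [Encodable P] (m : ℕ)
    (t : {t : ℕ // m.testBit t = true}) : Set (Form A P true) := bitType A P t.1

theorem finite_codeBelow (N : ℕ) : (codeBelow A P N).Finite :=
  Set.Finite.preimage Form.code_injective.injOn (Set.finite_Iic N)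

theorem code_le_neg (φ : Form A P true) : φ.code ≤ (neg φ).code := Nat.right_le_pair _ _

theorem code_le_and_left (φ ψ : Form A P true) : φ.code ≤ (Form.and φ ψ).code :=
  (Nat.left_le_pair _ _).trans (Nat.right_le_pair _ _)

theorem code_le_and_right (φ ψ : Form A P true) : ψ.code ≤ (Form.and φ ψ).code :=
  (Nat.right_le_pair _ _).trans (Nat.right_le_pair _ _)

theorem code_le_dist (B : Finset A) (φ : Form A P true) : φ.code ≤ (Form.dist B φ).code :=
  (Nat.right_le_pair _ _).trans (Nat.right_le_pair _ _)

theorem code_le_common (h : true = true) (B : Finset A) (φ : Form A P true) :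
    φ.code ≤ (common h B φ).code :=
  (Nat.right_le_pair _ _).trans (Nat.right_le_pair _ _)

/-- The code of a comparison. -/
noncomputable def cmpCode (B C : Finset A) : ℕ := Nat.pair 5 (Nat.pair (groupCode B) (groupCode C))

/-- A bound for the codes of all comparisons. -/
noncomputable def cmpBound (A : Type u) [Fintype A] [DecidableEq A] : ℕ :=
  ∑ B : Finset A, ∑ C : Finset A, cmpCode B C

theorem cmpCode_le (B C : Finset A) : cmpCode B C ≤ cmpBound A :=
  (Finset.single_le_sum (f := fun C => cmpCode B C) (fun _ _ => Nat.zero_le _)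
    (Finset.mem_univ C)).trans (Finset.single_le_sum (f := fun B => ∑ C, cmpCode B C)
      (fun _ _ => Nat.zero_le _) (Finset.mem_univ B))

theorem subClosed_codeBelow {N : ℕ} (hN : cmpBound A ≤ N) : SubClosed (codeBelow A P N) where
  neg_sub h := (code_le_neg _).trans h
  and_sub h := ⟨(code_le_and_left _ _).trans h, (code_le_and_right _ _).trans h⟩
  dist_sub h := (code_le_dist _ _).trans h
  common_sub h := (code_le_common _ _ _).trans h
  cmp_mem B C := (cmpCode_le B C).trans hN

/-- `KnownTo`, for the code of the formula. -/
def KnownToCode (C : Finset A) (x : ℕ) : Prop :=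
  (x.unpair.1 = 4 ∧ x.unpair.2.unpair.1 = groupCode C) ∨
  (x.unpair.1 = 5 ∧ x.unpair.2.unpair.1 = groupCode C) ∨
  (∃ B : Finset A, x.unpair.1 = 6 ∧ x.unpair.2.unpair.1 = groupCode B ∧ ∃ c ∈ C, c ∈ B)

theorem groupCode_inj {B C : Finset A} : groupCode B = groupCode C ↔ B = C :=
  ⟨fun h => (Fintype.equivFin (Finset A)).injective (Fin.ext h), fun h => h ▸ rfl⟩

theorem knownToCode_code (C : Finset A) (φ : Form A P true) :
    KnownToCode C φ.code ↔ KnownTo C φ := by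
  cases φ <;> simp [KnownToCode, KnownTo, Form.code, groupCode_inj]

/-- A formula is not valid if and only if it is missing in a type of a Hintikka system that is
given by a number with an explicit bound. -/
theorem not_valid_iff_exists_bitSystem {φ : Form A P true} {N : ℕ} (hN : cmpBound A ≤ N)
    (hφ : φ.code ≤ N) :
    ¬ Valid.{u, v, w} φ ↔ ∃ m < 2 ^ 2 ^ (N + 1),
      Hintikka (codeBelow A P N) (bitSystem A P m) ∧
        ∃ t, m.testBit t = true ∧ ¬ t.testBit φ.code = true := by
  constructor
  · intro hv
    obtain ⟨Γ, hΓ, hφΓ⟩ := exists_maxConsistent_of_not_provable fun h => hv (Provable.valid h)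
    choose num hnum hbit using fun Γ : Set (Form A P true) =>
      exists_testBit_iff (N + 1) fun i => ∃ ψ ∈ Γ, ψ.code = i
    have hmem : ∀ (Δ : Set (Form A P true)) {ψ : Form A P true}, ψ ∈ codeBelow A P N →
        ((num Δ).testBit ψ.code = true ↔ ψ ∈ Δ) := fun Δ ψ hψ => by
      rw [hbit]
      refine ⟨fun ⟨_, χ, hχ, h⟩ => Form.code_injective h ▸ hχ, fun h =>
        ⟨Nat.lt_succ_of_le hψ, ψ, h, rfl⟩⟩
    -- Types are numbers below `2 ^ (N + 1)`, and the set of those realised by maximal consistent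
    -- sets is again the digits of one number; hence the double exponential bound.
    obtain ⟨m, hm, hmbit⟩ := exists_testBit_iff (2 ^ (N + 1))
      fun t => ∃ Δ : Set (Form A P true), MaxConsistent Δ ∧ num Δ = t
    have hinter : ∀ Δ : Set (Form A P true),
        bitType A P (num Δ) ∩ codeBelow A P N = Δ ∩ codeBelow A P N := fun Δ => by
      ext ψ
      simp only [Set.mem_inter_iff]
      exact and_congr_left fun hψ => hmem Δ hψ
    refine ⟨m, hm, hintikka_of_maxConsistent (finite_codeBelow N) (subClosed_codeBelow hN)
      (fun t => ?_) fun Δ hΔ => ⟨⟨num Δ, (hmbit _).2 ⟨hnum Δ, Δ, hΔ, rfl⟩⟩, hinter Δ⟩,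
      num Γ, (hmbit _).2 ⟨hnum Γ, Γ, hΓ, rfl⟩, fun h => hφΓ ((hmem Γ hφ).1 h)⟩
    obtain ⟨t, ht⟩ := t
    obtain ⟨-, Δ, hΔ, rfl⟩ := (hmbit t).1 ht
    exact ⟨Δ, hΔ, hinter Δ⟩
  · rintro ⟨m, -, hH, t, ht, hφt⟩
    exact Hintikka.not_valid.{u, v, w, 0} (subClosed_codeBelow hN) hH hφ (x := ⟨t, ht⟩) hφt

/-- `TypeRel`, for types that are given by numbers. -/
def BitRel (A : Type u) (P : Type v) [Fintype A] [DecidableEq A] [Encodable P] (N : ℕ)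
    (B : Finset A) (t t' : ℕ) : Prop :=
  ∀ C : Finset A, t.testBit (cmpCode B C) = true → ∀ ψ : Form A P true, ψ.code ≤ N →
    KnownToCode C ψ.code → (t.testBit ψ.code = true ↔ t'.testBit ψ.code = true)

theorem typeRel_bitType_iff {N t t' : ℕ} {B : Finset A} :
    TypeRel (codeBelow A P N) B (bitType A P t) (bitType A P t') ↔ BitRel A P N B t t' := by
  simp only [BitRel, knownToCode_code]
  rfl

/-- The conditions of a Hintikka system, for a system that is given by a number. -/
def HintikkaCode (A : Type u) (P : Type v) [Fintype A] [DecidableEq A] [Encodable P]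
    (N m : ℕ) : Prop :=
  ∀ t, m.testBit t = true →
    ((∀ B C : Finset A, C ⊆ B → t.testBit (cmpCode B C) = true) ∧
    (∀ B C E : Finset A, t.testBit (cmpCode B C) = true → t.testBit (cmpCode B E) = true →
      t.testBit (cmpCode B (C ∪ E)) = true) ∧
    (∀ B C E : Finset A, t.testBit (cmpCode B C) = true → t.testBit (cmpCode C E) = true →
      t.testBit (cmpCode B E) = true)) ∧
    ∀ φ : Form A P true, φ.code ≤ N →
      (Nat.pair 2 φ.code ≤ N →
        (t.testBit (Nat.pair 2 φ.code) = true ↔ ¬ t.testBit φ.code = true)) ∧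
      (∀ ψ : Form A P true, ψ.code ≤ N → Nat.pair 3 (Nat.pair φ.code ψ.code) ≤ N →
        (t.testBit (Nat.pair 3 (Nat.pair φ.code ψ.code)) = true ↔
          t.testBit φ.code = true ∧ t.testBit ψ.code = true)) ∧
      ∀ B : Finset A,
        (Nat.pair 4 (Nat.pair (groupCode B) φ.code) ≤ N →
          (t.testBit (Nat.pair 4 (Nat.pair (groupCode B) φ.code)) = true →
            t.testBit φ.code = true) ∧
          (¬ t.testBit (Nat.pair 4 (Nat.pair (groupCode B) φ.code)) = true →
            ∃ t', m.testBit t' = true ∧ BitRel A P N B t t' ∧ ¬ t'.testBit φ.code = true)) ∧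
        (Nat.pair 6 (Nat.pair (groupCode B) φ.code) ≤ N →
          (t.testBit (Nat.pair 6 (Nat.pair (groupCode B) φ.code)) = true →
            t.testBit φ.code = true) ∧
          (¬ t.testBit (Nat.pair 6 (Nat.pair (groupCode B) φ.code)) = true →
            ∀ z < 2 ^ m, z.testBit t = true →
              (∀ b : A, b ∈ B → ∀ x, m.testBit x = true → z.testBit x = true →
                ∀ y, m.testBit y = true → BitRel A P N {b} x y → z.testBit y = true) →
              ∃ x, m.testBit x = true ∧ z.testBit x = true ∧ ¬ x.testBit φ.code = true))

theorem hintikka_bitSystem_iff (N m : ℕ) :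
    Hintikka (codeBelow A P N) (bitSystem A P m) ↔ HintikkaCode A P N m := by
  constructor
  · intro h t ht
    refine ⟨⟨fun B C => h.cmp_of_subset ⟨t, ht⟩ B C, fun B C E => h.cmp_union ⟨t, ht⟩ B C E,
      fun B C E => h.cmp_trans ⟨t, ht⟩ B C E⟩, fun φ _ => ⟨h.neg_mem ⟨t, ht⟩ φ,
      fun ψ _ => h.and_mem ⟨t, ht⟩ φ ψ, fun B => ⟨fun hB => ⟨h.dist_elim ⟨t, ht⟩ B φ hB,
      fun hn => ?_⟩, fun hB => ⟨h.common_elim ⟨t, ht⟩ rfl B φ hB, fun hn z _ hzt hz => ?_⟩⟩⟩⟩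
    · obtain ⟨⟨t', ht'⟩, hr, hφ⟩ := h.dist_witness ⟨t, ht⟩ B φ hB hn
      exact ⟨t', ht', typeRel_bitType_iff.1 hr, hφ⟩
    · obtain ⟨⟨x, hx⟩, hxz, hφ⟩ := h.common_witness ⟨t, ht⟩ rfl B φ hB hn
        {x | z.testBit x.1 = true} hzt
        fun b hb x hxz y hr => hz b hb x.1 x.2 hxz y.1 y.2 (typeRel_bitType_iff.1 hr)
      exact ⟨x, hx, hxz, hφ⟩
  · intro h
    constructor
    · exact fun t φ hφ => ((h t.1 t.2).2 φ ((code_le_neg φ).trans hφ)).1 hφ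
    · exact fun t φ ψ hφ => ((h t.1 t.2).2 φ ((code_le_and_left φ ψ).trans hφ)).2.1 ψ
        ((code_le_and_right φ ψ).trans hφ) hφ
    · exact fun t => (h t.1 t.2).1.1
    · exact fun t => (h t.1 t.2).1.2.1
    · exact fun t => (h t.1 t.2).1.2.2
    · exact fun t B φ hφ =>
        ((((h t.1 t.2).2 φ ((code_le_dist B φ).trans hφ)).2.2 B).1 hφ).1
    · intro t B φ hφ hn
      obtain ⟨t', ht', hr, hx⟩ :=
        ((((h t.1 t.2).2 φ ((code_le_dist B φ).trans hφ)).2.2 B).1 hφ).2 hn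
      exact ⟨⟨t', ht'⟩, typeRel_bitType_iff.2 hr, hx⟩
    · exact fun t hc B φ hφ =>
        ((((h t.1 t.2).2 φ ((code_le_common hc B φ).trans hφ)).2.2 B).2 hφ).1
    · intro t hc B φ hφ hn Z htZ hZ
      -- Members of the system are positions of digits of `m`, hence below `m`, so any subset `Z` is
      -- coded by some `z < 2 ^ m`.
      obtain ⟨z, hz, hbit⟩ := exists_testBit_iff m fun x => ∃ hx, ⟨x, hx⟩ ∈ Z
      obtain ⟨x, hx, hxz, hφx⟩ :=
        ((((h t.1 t.2).2 φ ((code_le_common hc B φ).trans hφ)).2.2 B).2 hφ).2 hn z hz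
          ((hbit _).2 ⟨lt_of_testBit t.2, t.2, htZ⟩) fun b hb x hx hxz y hy hr =>
            (hbit y).2 ⟨lt_of_testBit hy, hy, hZ b hb ⟨x, hx⟩ ((hbit x).1 hxz).2.2 ⟨y, hy⟩
              (typeRel_bitType_iff.2 hr)⟩
      exact ⟨⟨x, hx⟩, ((hbit x).1 hxz).2.2, hφx⟩

end Encodable

/-! ### The decision procedure -/

section Primrec

variable {α : Type*} [Primcodable α]

theorem primrecPred_knownToCode (C : Finset A) : PrimrecPred (KnownToCode C) := by
  have h₁ : Primrec fun x : ℕ => x.unpair.1 := Primrec.fst.comp .unpair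
  have h₂ : Primrec fun x : ℕ => x.unpair.2.unpair.1 :=
    Primrec.fst.comp (Primrec.unpair.comp (Primrec.snd.comp .unpair))
  have tag : ∀ {k : ℕ → ℕ} (_ : Primrec k) (i : ℕ), PrimrecPred fun a => k a = i :=
    fun hk i => Primrec.eq.comp hk (Primrec.const i)
  exact ((tag h₁ 4).and (tag h₂ _)).or <| ((tag h₁ 5).and (tag h₂ _)).or <|
    primrecPred_exists_finite fun B => (tag h₁ 6).and ((tag h₂ _).and (primrecPred_const _))

variable [Primcodable P]

theorem primrecPred_bitRel {N t t' : α → ℕ} (hN : Primrec N) (ht : Primrec t) (ht' : Primrec t')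
    (B : Finset A) : PrimrecPred fun a => BitRel A P (N a) B (t a) (t' a) := by
  refine primrecPred_forall_finite fun C =>
    primrecPred_imp (primrecPred_testBit ht (Primrec.const _)) ?_
  refine primrecPred_forall_form (A := A) (P := P) (p := fun a x =>
    KnownToCode C x → ((t a).testBit x = true ↔ (t' a).testBit x = true)) hN ?_
  exact primrecPred_imp ((primrecPred_knownToCode C).comp .snd)
    (primrecPred_iff (primrecPred_testBit (ht.comp .fst) .snd)
      (primrecPred_testBit (ht'.comp .fst) .snd))

theorem primrecPred_common_witness {N m t x : α → ℕ} (hN : Primrec N) (hm : Primrec m)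
    (ht : Primrec t) (hx : Primrec x) (B : Finset A) :
    PrimrecPred fun a => ∀ z < 2 ^ m a, z.testBit (t a) = true →
      (∀ b : A, b ∈ B → ∀ x, (m a).testBit x = true → z.testBit x = true →
        ∀ y, (m a).testBit y = true → BitRel A P (N a) {b} x y → z.testBit y = true) →
      ∃ y, (m a).testBit y = true ∧ z.testBit y = true ∧ ¬ y.testBit (x a) = true := by
  refine primrecPred_forall_lt (primrec_two_pow hm) <|
    primrecPred_imp (primrecPred_testBit .snd (ht.comp .fst)) <| primrecPred_imp ?_ ?_
  · refine primrecPred_forall_finite fun b => primrecPred_imp (primrecPred_const _) <|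
      primrecPred_forall_testBit (hm.comp .fst) <|
      primrecPred_imp (primrecPred_testBit (Primrec.snd.comp .fst) .snd) <|
      primrecPred_forall_testBit (hm.comp (Primrec.fst.comp .fst)) <| primrecPred_imp
        (primrecPred_bitRel (hN.comp (Primrec.fst.comp (Primrec.fst.comp .fst)))
          (Primrec.snd.comp .fst) .snd {b})
        (primrecPred_testBit (Primrec.snd.comp (Primrec.fst.comp .fst)) .snd)
  · exact primrecPred_exists_testBit (hm.comp .fst) <|
      (primrecPred_testBit (Primrec.snd.comp .fst) .snd).and
        (primrecPred_testBit .snd (hx.comp (Primrec.fst.comp .fst))).not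

theorem primrecPred_hintikkaCode {N m : α → ℕ} (hN : Primrec N) (hm : Primrec m) :
    PrimrecPred fun a => HintikkaCode A P (N a) (m a) := by
  refine primrecPred_forall_testBit hm (.and ?_ ?_)
  · have hbit : ∀ B C : Finset A, PrimrecPred fun q : α × ℕ => q.2.testBit (cmpCode B C) = true :=
      fun B C => primrecPred_testBit .snd (.const _)
    refine .and ?_ (.and ?_ ?_)
    · exact primrecPred_forall_finite fun B => primrecPred_forall_finite fun C =>
        primrecPred_imp (primrecPred_const _) (hbit B C)
    · exact primrecPred_forall_finite fun B => primrecPred_forall_finite fun C =>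
        primrecPred_forall_finite fun E => primrecPred_imp (hbit _ _)
          (primrecPred_imp (hbit _ _) (hbit _ _))
    · exact primrecPred_forall_finite fun B => primrecPred_forall_finite fun C =>
        primrecPred_forall_finite fun E => primrecPred_imp (hbit _ _)
          (primrecPred_imp (hbit _ _) (hbit _ _))
  have hN₂ : Primrec fun q : (α × ℕ) × ℕ => N q.1.1 := hN.comp (Primrec.fst.comp .fst)
  have hm₂ : Primrec fun q : (α × ℕ) × ℕ => m q.1.1 := hm.comp (Primrec.fst.comp .fst)
  have ht : Primrec fun q : (α × ℕ) × ℕ => q.1.2 := Primrec.snd.comp .fst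
  have hx : Primrec fun q : (α × ℕ) × ℕ => q.2 := Primrec.snd
  have hpair : ∀ i j : ℕ, Primrec fun q : (α × ℕ) × ℕ => Nat.pair i (Nat.pair j q.2) :=
    fun i j => Primrec₂.natPair.comp (.const i) (Primrec₂.natPair.comp (.const j) hx)
  refine primrecPred_forall_form (A := A) (P := P)
    (p := fun (q : α × ℕ) (x : ℕ) => (Nat.pair 2 x ≤ N q.1 →
        (q.2.testBit (Nat.pair 2 x) = true ↔ ¬ q.2.testBit x = true)) ∧
      (∀ ψ : Form A P true, ψ.code ≤ N q.1 → Nat.pair 3 (Nat.pair x ψ.code) ≤ N q.1 →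
        (q.2.testBit (Nat.pair 3 (Nat.pair x ψ.code)) = true ↔
          q.2.testBit x = true ∧ q.2.testBit ψ.code = true)) ∧
      ∀ B : Finset A,
        (Nat.pair 4 (Nat.pair (groupCode B) x) ≤ N q.1 →
          (q.2.testBit (Nat.pair 4 (Nat.pair (groupCode B) x)) = true →
            q.2.testBit x = true) ∧
          (¬ q.2.testBit (Nat.pair 4 (Nat.pair (groupCode B) x)) = true →
            ∃ t', (m q.1).testBit t' = true ∧ BitRel A P (N q.1) B q.2 t' ∧
              ¬ t'.testBit x = true)) ∧
        (Nat.pair 6 (Nat.pair (groupCode B) x) ≤ N q.1 →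
          (q.2.testBit (Nat.pair 6 (Nat.pair (groupCode B) x)) = true →
            q.2.testBit x = true) ∧
          (¬ q.2.testBit (Nat.pair 6 (Nat.pair (groupCode B) x)) = true →
            ∀ z < 2 ^ m q.1, z.testBit q.2 = true →
              (∀ b : A, b ∈ B → ∀ x, (m q.1).testBit x = true → z.testBit x = true →
                ∀ y, (m q.1).testBit y = true → BitRel A P (N q.1) {b} x y →
                  z.testBit y = true) →
              ∃ y, (m q.1).testBit y = true ∧ z.testBit y = true ∧ ¬ y.testBit x = true)))
    (hN.comp .fst) (.and ?_ (.and ?_ (primrecPred_forall_finite fun B => .and ?_ ?_)))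
  · have h2 := Primrec₂.natPair.comp (Primrec.const 2) hx
    exact primrecPred_imp (Primrec.nat_le.comp h2 hN₂)
      (primrecPred_iff (primrecPred_testBit ht h2) (primrecPred_testBit ht hx).not)
  · have h3 : Primrec fun q : ((α × ℕ) × ℕ) × ℕ => Nat.pair 3 (Nat.pair q.1.2 q.2) :=
      Primrec₂.natPair.comp (.const 3) (Primrec₂.natPair.comp (hx.comp .fst) .snd)
    refine primrecPred_forall_form (A := A) (P := P) (p := fun (q : (α × ℕ) × ℕ) (y : ℕ) =>
      Nat.pair 3 (Nat.pair q.2 y) ≤ N q.1.1 →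
        (q.1.2.testBit (Nat.pair 3 (Nat.pair q.2 y)) = true ↔
          q.1.2.testBit q.2 = true ∧ q.1.2.testBit y = true)) hN₂ ?_
    exact primrecPred_imp (Primrec.nat_le.comp h3 (hN₂.comp .fst))
      (primrecPred_iff (primrecPred_testBit (ht.comp .fst) h3)
        ((primrecPred_testBit (ht.comp .fst) (hx.comp .fst)).and
          (primrecPred_testBit (ht.comp .fst) .snd)))
  · have h4 := hpair 4 (groupCode B)
    refine primrecPred_imp (Primrec.nat_le.comp h4 hN₂) (.and ?_ ?_)
    · exact primrecPred_imp (primrecPred_testBit ht h4) (primrecPred_testBit ht hx)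
    · exact primrecPred_imp (primrecPred_testBit ht h4).not <|
        primrecPred_exists_testBit hm₂ <|
        (primrecPred_bitRel (hN₂.comp .fst) (ht.comp .fst) .snd B).and
          (primrecPred_testBit .snd (hx.comp .fst)).not
  · have h6 := hpair 6 (groupCode B)
    refine primrecPred_imp (Primrec.nat_le.comp h6 hN₂) (.and ?_ ?_)
    · exact primrecPred_imp (primrecPred_testBit ht h6) (primrecPred_testBit ht hx)
    · exact primrecPred_imp (primrecPred_testBit ht h6).not
        (primrecPred_common_witness hN₂ hm₂ ht hx B)

/-- The set of valid formulas is decidable. -/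
theorem decidableSet_valid :
    DecidableSet {φ : Form A P true | Valid.{u, v, w} φ} := by
  -- Adding `cmpBound A` places all comparisons, along with the formula coded by `n`, below the
  -- bound.
  have hN : Primrec fun n : ℕ => n + cmpBound A := Primrec.nat_add.comp .id (.const _)
  have hbad : PrimrecPred fun n : ℕ => ∃ m < 2 ^ 2 ^ (n + cmpBound A + 1),
      HintikkaCode A P (n + cmpBound A) m ∧
        ∃ t, m.testBit t = true ∧ ¬ t.testBit n = true :=
    primrecPred_exists_lt (primrec_two_pow (primrec_two_pow (Primrec.succ.comp hN)))
      ((primrecPred_hintikkaCode (hN.comp .fst) .snd).and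
        (primrecPred_exists_testBit .snd
          (primrecPred_testBit .snd (Primrec.fst.comp .fst)).not))
  refine (((primrecPred_exists_code_eq A P).and hbad.not).of_eq fun n => ?_).computablePred
  have hiff : ∀ φ : Form A P true, Valid.{u, v, w} φ ↔
      ¬ ∃ m < 2 ^ 2 ^ (φ.code + cmpBound A + 1), HintikkaCode A P (φ.code + cmpBound A) m ∧
        ∃ t, m.testBit t = true ∧ ¬ t.testBit φ.code = true := fun φ => by
    simp only [← hintikka_bitSystem_iff]
    rw [← not_valid_iff_exists_bitSystem (Nat.le_add_left _ _) (Nat.le_add_right _ _), not_not]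
  constructor
  · rintro ⟨⟨φ, rfl⟩, h⟩
    exact ⟨φ, (hiff φ).2 h, rfl⟩
  · rintro ⟨φ, hφ, rfl⟩
    exact ⟨⟨φ, rfl⟩, (hiff φ).1 hφ⟩

end Primrec

end EpistemicLogic

theorem proposition1 (A : Type u) [Fintype A] [DecidableEq A] (P : Type v) :
    -- `LDC⪯` is decidable (for an effectively numbered set of atomic propositions)
    (∀ _ : Primcodable P,
      EpistemicLogic.DecidableSet
        {φ : EpistemicLogic.Form A P true | EpistemicLogic.Valid.{u, v, w} φ}) ∧
    -- the proof system `LDC⪯` is sound and complete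
    (∀ φ : EpistemicLogic.Form A P true,
      EpistemicLogic.Provable φ ↔ EpistemicLogic.Valid.{u, v, w} φ) ∧
    -- the proof system `LD⪯` is sound and complete for the fragment without common knowledge
    (∀ φ : EpistemicLogic.Form A P false,
      EpistemicLogic.Provable φ ↔ EpistemicLogic.Valid.{u, v, w} φ) := by
  refine ⟨fun _ => EpistemicLogic.decidableSet_valid, fun φ => ⟨fun h => h.valid, fun h => ?_⟩,
    fun φ => ⟨fun h => h.valid, fun h => ?_⟩⟩
  · exact h.provable
  · exact h.provable
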